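/- **Setting.** Write $x\sim y$ for nearest neighbours in $\mathbb Z^2$. For a finite set $\Lambda\subset\mathbb Z^2$ let $\partial\Lambda$ be the set of vertices outside $\Lambda$ which have a neighbour in $\Lambda$, and for $\phi\in\mathbb Z^\Lambda$ let $$\mathcal H_\Lambda(\phi)=\frac12\sum_{x,y\in\Lambda,\ x\sim y}|\phi(x)-\phi(y)|+\sum_{x\in\Lambda,\ y\in\partial\Lambda,\ x\sim y}|\phi(x)| .$$ For $\beta>0$, the solid-on-solid measure with zero boundary condition is the probability measure on $\mathbb Z^\Lambda$ given by $\mathbf P_{\Lambda,\beta}(\phi)=e^{-\beta\mathcal H_\Lambda(\phi)}/\mathcal Z_{\Lambda,\beta}$, where $\mathcal Z_{\Lambda,\beta}=\sum_{\phi\in\mathbb Z^\Lambda}e^{-\beta\mathcal H_\Lambda(\phi)}$. Let $(\mathbb Z^2)^*=\mathbb Z^2+(\frac12,\frac12)$ be the dual lattice. Two distinct dual edges meeting at a dual vertex $x^*$ are *linked* if they lie on the same side of the line through $x^*$ making an angle $\pi/4$ with the horizontal. A *geometric contour* is a finite set $\tilde\gamma$ of dual edges which can be ordered as a closed path $(e_1,\dots,e_m)$,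 $m\ge 3$, of distinct edges such that $e_i$ and $e_{i+1}$ share an end point for every $i$ (with $e_{m+1}=e_1$) and such that, whenever $i\ne j$ and $e_i,e_{i+1},e_j,e_{j+1}$ meet at a common point, $e_i,e_{i+1}$ are linked and so are $e_j,e_{j+1}$. A *contour* $\gamma$ is a geometric contour $\tilde\gamma$ together with a sign $\pm$; its length $|\tilde\gamma|$ is its number of edges, and its interior $\bar\gamma$ is the set of vertices of $\mathbb Z^2$ enclosed by it, that is, the vertices $x$ such that the horizontal half-line going from $x$ to the right crosses an odd number of edges of $\tilde\gamma$. **Proposition.** Let $\beta>0$ satisfy $$\sum_{\gamma\,:\,\mathbf 0\in\bar\gamma}e^{-\beta|\tilde\gamma|}<\infty .$$ Then there is a constant $C=C(\beta)$ such that for every integer $n\ge1$ and every finite $\Lambda\subset\mathbb Z^2$: 1. for every $x\in\Lambda$, $$\tfrac12e^{-4\beta n}\le\mathbf P_{\Lambda,\beta}[\phi(x)\ge n]\le Ce^{-4\beta n};$$ 2. for all $x,y\in\Lambda$ with $x\sim y$, $$\tfrac14e^{-6\beta n}\le\mathbf P_{\Lambda,\beta}[\min(\phi(x),\phi(y))\ge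 n]\le Ce^{-6\beta n};$$ 3. for all distinct $x,y,z\in\Lambda$ with $x\sim y\sim z$, $$\tfrac18e^{-8\beta n}\le\mathbf P_{\Lambda,\beta}[\min(\phi(x),\phi(y),\phi(z))\ge n]\le C\,n\,e^{-8\beta n},$$ and if moreover $x,y,z$ are aligned (that is, $x+z=2y$), then $$\mathbf P_{\Lambda,\beta}[\min(\phi(x),\phi(y),\phi(z))\ge n]\le Ce^{-8\beta n}.$$ -/

import Mathlib

open MeasureTheory
open scoped ENNReal

namespace SOS

/-- Nearest-neighbour adjacency `x ∼ y` on `ℤ²`. -/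
def Adj (x y : ℤ × ℤ) : Prop := |x.1 - y.1| + |x.2 - y.2| = 1

instance (x y : ℤ × ℤ) : Decidable (Adj x y) :=
  inferInstanceAs (Decidable (|x.1 - y.1| + |x.2 - y.2| = 1))

/-! ### The solid-on-solid measure with zero boundary condition -/

/-- The four nearest neighbours of `x`. -/
def nbrs (x : ℤ × ℤ) : Finset (ℤ × ℤ) :=
  {(x.1 + 1, x.2), (x.1 - 1, x.2), (x.1, x.2 + 1), (x.1, x.2 - 1)}

/-- The external boundary `∂Λ` of a finite set `Λ ⊂ ℤ²`. -/
def boundary (Λ : Finset (ℤ × ℤ)) : Finset (ℤ × ℤ) := Λ.biUnion nbrs \ Λ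

theorem mem_nbrs {x y : ℤ × ℤ} : y ∈ nbrs x ↔ Adj y x := by
  obtain ⟨a, b⟩ := x
  obtain ⟨c, d⟩ := y
  simp only [nbrs, Adj, Finset.mem_insert, Finset.mem_singleton, Prod.mk.injEq]
  rcases abs_cases (c - a) with h | h <;> rcases abs_cases (d - b) with h' | h' <;> omega

/-- `∂Λ` is the set of the vertices outside `Λ` that have a neighbour in `Λ`. -/
theorem mem_boundary {Λ : Finset (ℤ × ℤ)} {x : ℤ × ℤ} :
    x ∈ boundary Λ ↔ x ∉ Λ ∧ ∃ y ∈ Λ, Adj x y := by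
  simp only [boundary, Finset.mem_sdiff, Finset.mem_biUnion, mem_nbrs]
  tauto

/-- The SOS Hamiltonian with zero boundary condition: half the sum of `|φ(x) - φ(y)|` over the
ordered pairs `x ∼ y` in `Λ`, plus the sum of `|φ(x) - 0|` over `x ∈ Λ`, `y ∈ ∂Λ`, `x ∼ y`. -/
noncomputable def hamiltonian (Λ : Finset (ℤ × ℤ)) (φ : Λ → ℤ) : ℝ :=
  (1 / 2 : ℝ) * (∑ x : Λ, ∑ y : Λ, if Adj x y then |(φ x : ℝ) - (φ y : ℝ)| else 0)
    + ∑ x : Λ, ∑ y ∈ boundary Λ, if Adj x y then |(φ x : ℝ)| else 0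

/-- The Boltzmann weight `exp(-β H_Λ(φ))`. -/
noncomputable def weight (Λ : Finset (ℤ × ℤ)) (β : ℝ) (φ : Λ → ℤ) : ℝ≥0∞ :=
  ENNReal.ofReal (Real.exp (-β * hamiltonian Λ φ))

/-- The partition function `Z_{Λ,β}`. -/
noncomputable def partitionFunction (Λ : Finset (ℤ × ℤ)) (β : ℝ) : ℝ≥0∞ :=
  ∑' φ : Λ → ℤ, weight Λ β φ

/-- The SOS measure `P_{Λ,β}` on `ℤ^Λ`: the atom at `φ` has mass `exp(-β H_Λ(φ)) / Z_{Λ,β}`. -/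
noncomputable def sosMeasure (Λ : Finset (ℤ × ℤ)) (β : ℝ) : Measure (Λ → ℤ) :=
  (partitionFunction Λ β)⁻¹ • Measure.sum fun φ => weight Λ β φ • Measure.dirac φ

/-! ### Contours

The dual lattice `(ℤ²)*` is represented by `ℤ × ℤ` as well: the pair `(a, b)` stands for the point
`(a + 1/2, b + 1/2)` of the plane, so that dual adjacency is again `Adj`. A dual edge is the
unordered pair of its end points. -/

/-- `e` is an edge of the dual lattice. -/
def IsDualEdge (e : Sym2 (ℤ × ℤ)) : Prop := ∃ p q : ℤ × ℤ, Adj p q ∧ e = s(p, q)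

/-- Whether `q` lies above (`> 0`) or below (`< 0`) the line through `p` which makes an angle `π/4`
with the horizontal. -/
def side (p q : ℤ × ℤ) : ℤ := (q.2 - p.2) - (q.1 - p.1)

/-- Two distinct dual edges `e` and `f` meeting at `p` are linked at `p` if they lie on the same
side of the line through `p` which makes an angle `π/4` with the horizontal. -/
def LinkedAt (p : ℤ × ℤ) (e f : Sym2 (ℤ × ℤ)) : Prop :=
  ∃ q r : ℤ × ℤ, Adj p q ∧ Adj p r ∧ q ≠ r ∧ e = s(p, q) ∧ f = s(p, r) ∧
    (0 < side p q ↔ 0 < side p r)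

/-- Contour sequences: cyclic sequences `e` of `n` distinct dual edges such that consecutive ones
share an end point, and such that whenever two different pairs of consecutive edges meet at one
common point, each of these two pairs is linked there. The condition `3 ≤ n` only discards the
degenerate sequences of one or two edges, which are not closed paths. -/
structure IsContourSeq (n : ℕ) (e : ZMod n → Sym2 (ℤ × ℤ)) : Prop where
  three_le : 3 ≤ n
  dualEdge : ∀ i, IsDualEdge (e i)
  injective : Function.Injective e
  consecutive : ∀ i, ∃ p, p ∈ e i ∧ p ∈ e (i + 1)
  linked : ∀ i j, i ≠ j → ∀ p, p ∈ e i → p ∈ e (i + 1) → p ∈ e j → p ∈ e (j + 1) →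
    LinkedAt p (e i) (e (i + 1)) ∧ LinkedAt p (e j) (e (j + 1))

/-- A geometric contour: a set of dual edges which forms a contour sequence when suitably
ordered. -/
def IsGeometricContour (γ : Finset (Sym2 (ℤ × ℤ))) : Prop :=
  ∃ (n : ℕ) (e : ZMod n → Sym2 (ℤ × ℤ)), IsContourSeq n e ∧ (γ : Set (Sym2 (ℤ × ℤ))) = Set.range e

/-- A (signed) contour. -/
structure Contour where
  /-- the set of dual edges of the contour -/
  edges : Finset (Sym2 (ℤ × ℤ))
  isGeometricContour : IsGeometricContour edges
  /-- the sign of the contour -/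
  sign : ℤˣ

/-- The length of a contour, that is, its number of edges. -/
def Contour.length (γ : Contour) : ℕ := γ.edges.card

/-- The dual edge that crosses the edge from `(a, b)` to `(a + 1, b)` of `ℤ²`: it joins
`(a + 1/2, b - 1/2)` to `(a + 1/2, b + 1/2)`. -/
def crossingEdge (a b : ℤ) : Sym2 (ℤ × ℤ) := s((a, b - 1), (a, b))

open Classical in
/-- The interior of a contour, that is, the set of the vertices of `ℤ²` it encloses. The closed
curve drawn by the contour, with its corners rounded off where two pairs of linked edges meet, is
simple, so that by the even-odd rule `x` is enclosed if and only if the horizontal half-line going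
from `x` to the right crosses an odd number of edges of the contour. -/
def Contour.interior (γ : Contour) : Set (ℤ × ℤ) :=
  {x | Odd (γ.edges.filter fun e => ∃ k : ℕ, e = crossingEdge (x.1 + k) x.2).card}

/-- The contour summability condition: the sum of `exp(-β |γ|)` over all the contours `γ` which
enclose the origin is finite. -/
def ContourSummable (β : ℝ) : Prop :=
  Summable fun γ : {γ : Contour // ((0, 0) : ℤ × ℤ) ∈ γ.interior} =>
    Real.exp (-β * (γ.1.length : ℝ))

end SOS

/-! Lower bounds. Fold the heights about -1/2, that is, write each height as a distance to -1/2
together with a sign. Given the distances, the signs form a ferromagnetic Ising model with plus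
boundary condition. Griffiths' inequality then makes all signs on `A` equal to plus with probability
at least 2^(-|A|); this is `partitionFunction_le_two_pow`. Raising the heights on `A` by n turns
nonnegative heights into heights at least n, and costs at most n times the perimeter of `A`, which
is 4, 6 or 8 in the three cases (`le_sosMeasure_real_forall`).

Upper bounds. If φ ≥ n on `A`, then for each level k = 1, ..., n the boundary of {φ ≥ k} contains
contours, with interior on the side of the level set, that together enclose `A`. Lowering φ by 1
inside each of them lowers the energy by exactly their total length (`exists_energy_eq`). The
lowered field may have negative values outside Λ, since a contour may surround holes of Λ. This is
harmless: among bounded nonpositive boundary conditions the zero one has the largest partition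
function (`bdryPartition_le_zero`), which follows from repeated reflections and again Griffiths'
inequality.

The field subtracted from φ depends only on how often each family of contours is used, not on the
levels at which it is used. A union bound therefore runs over multisets of n families
(`sosMeasure_real_le_sum`), and this avoids a constant to the power n. The sum over multisets is a
coefficient of a product of geometric series. After e^(-βl), with l the minimal length of a family,
is factored out of every term, the r minimal families have weight 1 and contribute at most
(n+1)^(r-1). All others together contribute a constant, uniform in Λ by contour summability
(`sosMeasure_real_le_of_coverings`).

It remains to find the minimal families. A contour is at least as long as the perimeter of the
bounding box of its interior (`IsSeparating.le_card`), so l = 4, 6, 8. The minimal family is unique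
except around an L-shaped triple, where the 2 × 2 square also has perimeter 8. Thus r ≤ 2 there,
which is the origin of the factor n. -/

namespace SOS

/-! ### Nearest-neighbour edges and the energy of an extended height function -/

/-- The two positive unit vectors of `ℤ²`. -/
def unitVec : Bool → ℤ × ℤ
  | false => (1, 0)
  | true => (0, 1)

/-- The end point of the nearest-neighbour edge `e`, which starts at `e.1`. -/
def tgt (e : (ℤ × ℤ) × Bool) : ℤ × ℤ := e.1 + unitVec e.2

/-- The dual edge that crosses a nearest-neighbour edge. -/
def dualEdge (e : (ℤ × ℤ) × Bool) : Sym2 (ℤ × ℤ) :=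
  bif e.2 then s((e.1.1 - 1, e.1.2), (e.1.1, e.1.2)) else crossingEdge e.1.1 e.1.2

/-- The edges with an end point in `Λ`. -/
def touching (Λ : Finset (ℤ × ℤ)) : Finset ((ℤ × ℤ) × Bool) :=
  Λ ×ˢ Finset.univ ∪ (Λ ×ˢ Finset.univ).image fun e => (e.1 - unitVec e.2, e.2)

theorem mem_touching {Λ : Finset (ℤ × ℤ)} {e : (ℤ × ℤ) × Bool} :
    e ∈ touching Λ ↔ e.1 ∈ Λ ∨ tgt e ∈ Λ := by
  obtain ⟨u, i⟩ := e
  simp only [touching, tgt, Finset.mem_union, Finset.mem_product, Finset.mem_univ, and_true,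
    Finset.mem_image]
  refine or_congr_right ⟨?_, fun h => ⟨(u + unitVec i, i), h, by simp⟩⟩
  rintro ⟨⟨v, j⟩, hv, h⟩
  obtain ⟨rfl, rfl⟩ := Prod.mk.inj h
  simpa using hv

theorem sum_touching_fst {M : Type*} [AddCommMonoid M] {A Λ : Finset (ℤ × ℤ)} (hA : A ⊆ Λ)
    (f : (ℤ × ℤ) × Bool → M) :
    ∑ e ∈ touching Λ with e.1 ∈ A, f e = ∑ u ∈ A, ∑ i : Bool, f (u, i) := by
  rw [← Finset.sum_product']
  refine Finset.sum_congr ?_ fun _ _ => rfl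
  ext ⟨u, i⟩
  simp only [Finset.mem_filter, mem_touching, Finset.mem_product, Finset.mem_univ, and_true]
  exact ⟨fun h => h.2, fun h => ⟨Or.inl (hA h), h⟩⟩

theorem sum_touching_tgt {M : Type*} [AddCommMonoid M] {A Λ : Finset (ℤ × ℤ)} (hA : A ⊆ Λ)
    (f : (ℤ × ℤ) × Bool → M) :
    ∑ e ∈ touching Λ with tgt e ∈ A, f e = ∑ u ∈ A, ∑ i : Bool, f (u - unitVec i, i) := by
  rw [← Finset.sum_product']
  refine Finset.sum_nbij' (fun e => (tgt e, e.2)) (fun e => (e.1 - unitVec e.2, e.2)) ?_ ?_ ?_ ?_ ?_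
  · rintro ⟨u, i⟩ h
    simpa using (Finset.mem_filter.1 h).2
  · rintro ⟨u, i⟩ h
    have h' : u ∈ A := by simpa using h
    have h'' : tgt (u - unitVec i, i) = u := by simp [tgt]
    simp only [Finset.mem_filter, mem_touching, h'']
    exact ⟨Or.inr (hA h'), h'⟩
  · rintro ⟨u, i⟩ _
    simp [tgt]
  · rintro ⟨u, i⟩ _
    simp [tgt]
  · rintro ⟨u, i⟩ _
    simp [tgt]

theorem sum_nbrs {M : Type*} [AddCommMonoid M] (x : ℤ × ℤ) (f : ℤ × ℤ → M) :
    ∑ y ∈ nbrs x, f y = ∑ i : Bool, (f (x + unitVec i) + f (x - unitVec i)) := by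
  obtain ⟨a, b⟩ := x
  rw [nbrs, Finset.sum_insert, Finset.sum_insert, Finset.sum_insert, Finset.sum_singleton]
  · simp [unitVec]
    abel
  all_goals simp <;> omega

theorem Adj.symm {x y : ℤ × ℤ} (h : Adj x y) : Adj y x := by
  unfold Adj at *
  rwa [abs_sub_comm, abs_sub_comm y.2]

/-- An edge inside Λ is seen from both its end points, with weight 1/2 each time; an edge to the
boundary is seen once, with weight 1. The function `c` records these weights. -/
theorem sum_touching_eq {Λ : Finset (ℤ × ℤ)} (F : ℤ × ℤ → ℤ × ℤ → ℝ)
    (hF : ∀ x y, F x y = F y x) :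
    ∑ e ∈ touching Λ, F e.1 (tgt e) =
      (1 / 2 : ℝ) * (∑ x ∈ Λ, ∑ y ∈ Λ, if Adj x y then F x y else 0)
        + ∑ x ∈ Λ, ∑ y ∈ boundary Λ, if Adj x y then F x y else 0 := by
  classical
  let c : ℤ × ℤ → ℝ := fun y => if y ∈ Λ then 1 / 2 else 1
  have h1 : ∀ x ∈ Λ, (1 / 2 : ℝ) * (∑ y ∈ Λ, if Adj x y then F x y else 0) +
      (∑ y ∈ boundary Λ, if Adj x y then F x y else 0) = ∑ y ∈ nbrs x, c y * F x y := by
    intro x hx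
    rw [← Finset.sum_filter, ← Finset.sum_filter]
    have e1 : Λ.filter (Adj x) = (nbrs x).filter (· ∈ Λ) := by
      ext y
      simp only [Finset.mem_filter, mem_nbrs]
      exact ⟨fun h => ⟨h.2.symm, h.1⟩, fun h => ⟨h.2, h.1.symm⟩⟩
    have e2 : (boundary Λ).filter (Adj x) = (nbrs x).filter (· ∉ Λ) := by
      ext y
      simp only [Finset.mem_filter, mem_nbrs, mem_boundary]
      exact ⟨fun h => ⟨h.2.symm, h.1.1⟩, fun h => ⟨⟨h.2, x, hx, h.1⟩, h.1.symm⟩⟩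
    rw [e1, e2, ← Finset.sum_filter_add_sum_filter_not (nbrs x) (· ∈ Λ), Finset.mul_sum]
    congr 1
    · refine Finset.sum_congr rfl fun y hy => ?_
      simp [c, (Finset.mem_filter.1 hy).2]
    · refine Finset.sum_congr rfl fun y hy => ?_
      simp [c, (Finset.mem_filter.1 hy).2]
  rw [Finset.mul_sum, ← Finset.sum_add_distrib, Finset.sum_congr rfl h1]
  have h2 : ∀ e ∈ touching Λ, F e.1 (tgt e) =
      (if e.1 ∈ Λ then c (tgt e) * F e.1 (tgt e) else 0) +
      (if tgt e ∈ Λ then c e.1 * F (tgt e) e.1 else 0) := by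
    intro e he
    rw [mem_touching] at he
    rw [hF (tgt e) e.1]
    by_cases h : e.1 ∈ Λ <;> by_cases h' : tgt e ∈ Λ <;> simp_all [c]
    ring
  rw [Finset.sum_congr rfl h2, Finset.sum_add_distrib, ← Finset.sum_filter, ← Finset.sum_filter,
    sum_touching_fst subset_rfl, sum_touching_tgt subset_rfl, ← Finset.sum_add_distrib]
  refine Finset.sum_congr rfl fun x _ => ?_
  rw [sum_nbrs, Finset.sum_add_distrib]
  simp [tgt]

/-- The energy of a height function on `ℤ²` carried by the edges that touch `Λ`. -/
def energy (Λ : Finset (ℤ × ℤ)) (ψ : ℤ × ℤ → ℤ) : ℤ :=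
  ∑ e ∈ touching Λ, |ψ e.1 - ψ (tgt e)|

/-- The height function equal to `φ` on `Λ` and to `a` outside. -/
def extend {Λ : Finset (ℤ × ℤ)} (φ : Λ → ℤ) (a : ℤ × ℤ → ℤ) (x : ℤ × ℤ) : ℤ :=
  if h : x ∈ Λ then φ ⟨x, h⟩ else a x

theorem extend_coe {Λ : Finset (ℤ × ℤ)} (φ : Λ → ℤ) (a : ℤ × ℤ → ℤ) (x : Λ) :
    extend φ a x = φ x := by
  simp [extend]

theorem extend_of_notMem {Λ : Finset (ℤ × ℤ)} (φ : Λ → ℤ) (a : ℤ × ℤ → ℤ) {x : ℤ × ℤ}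
    (hx : x ∉ Λ) : extend φ a x = a x := by
  simp [extend, hx]

theorem energy_nonneg (Λ : Finset (ℤ × ℤ)) (ψ : ℤ × ℤ → ℤ) : 0 ≤ energy Λ ψ :=
  Finset.sum_nonneg fun _ _ => abs_nonneg _

theorem hamiltonian_eq (Λ : Finset (ℤ × ℤ)) (φ : Λ → ℤ) :
    hamiltonian Λ φ = energy Λ (extend φ 0) := by
  have := sum_touching_eq (Λ := Λ) (fun x y => |(extend φ 0 x : ℝ) - extend φ 0 y|)
    (fun x y => abs_sub_comm _ _)
  simp only [energy, Int.cast_sum, Int.cast_abs, Int.cast_sub]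
  rw [this, hamiltonian, ← Finset.sum_coe_sort Λ, ← Finset.sum_coe_sort Λ]
  congr 1
  · congr 1
    refine Finset.sum_congr rfl fun x _ => ?_
    rw [← Finset.sum_coe_sort Λ]
    refine Finset.sum_congr rfl fun y _ => ?_
    rw [extend_coe, extend_coe]
  · refine Finset.sum_congr rfl fun x _ => Finset.sum_congr rfl fun y hy => ?_
    rw [extend_coe, extend_of_notMem _ _ (mem_boundary.1 hy).1]
    simp

section

/-! ### A Griffiths inequality -/

theorem sum_character_nonneg {G : Type*} [CommGroup G] [Fintype G] (η : G →* ℤˣ) :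
    0 ≤ ∑ g, ((η g : ℤ) : ℝ) := by
  classical
  let f : G →* ℝ := ((Int.castRingHom ℝ).toMonoidHom.comp (Units.coeHom ℤ)).comp η
  change 0 ≤ ∑ g, f g
  by_cases hf : f = 1
  · simp [hf]
  · rw [sum_hom_units_eq_zero f hf]

/-- Griffiths' first inequality, with monotonicity in the couplings. -/
theorem abs_sum_character_mul_prod_le {G ι : Type*} [CommGroup G] [Fintype G] (I : Finset ι)
    (χ : ι → G →* ℤˣ) (α δ δ' : ι → ℝ) (hα : ∀ i, 0 ≤ α i) (hδ : ∀ i, |δ i| ≤ δ' i) :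
    ∀ η : G →* ℤˣ, |∑ g, ((η g : ℤ) : ℝ) * ∏ i ∈ I, (α i + δ i * ((χ i g : ℤ) : ℝ))| ≤
      ∑ g, ((η g : ℤ) : ℝ) * ∏ i ∈ I, (α i + δ' i * ((χ i g : ℤ) : ℝ)) := by
  classical
  induction I using Finset.induction_on with
  | empty =>
    intro η
    simp only [Finset.prod_empty, mul_one]
    exact (abs_of_nonneg (sum_character_nonneg η)).le
  | insert i I hi ih =>
    intro η
    -- Splitting off one factor either keeps the character η or multiplies it by `χ i`; hence the
    -- induction is over all η at once.
    have key : ∀ d : ι → ℝ,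
        ∑ g, ((η g : ℤ) : ℝ) * ∏ i ∈ insert i I, (α i + d i * ((χ i g : ℤ) : ℝ)) =
        α i * (∑ g, ((η g : ℤ) : ℝ) * ∏ i ∈ I, (α i + d i * ((χ i g : ℤ) : ℝ))) +
        d i * (∑ g, (((η * χ i) g : ℤ) : ℝ) * ∏ i ∈ I, (α i + d i * ((χ i g : ℤ) : ℝ))) := by
      intro d
      rw [Finset.mul_sum, Finset.mul_sum, ← Finset.sum_add_distrib]
      refine Finset.sum_congr rfl fun g _ => ?_
      rw [Finset.prod_insert hi, MonoidHom.mul_apply]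
      push_cast
      ring
    rw [key, key]
    refine (abs_add_le _ _).trans (add_le_add ?_ ?_)
    · rw [abs_mul, abs_of_nonneg (hα i)]
      exact mul_le_mul_of_nonneg_left (ih η) (hα i)
    · rw [abs_mul]
      exact mul_le_mul (hδ i) (ih _) (abs_nonneg _) ((abs_nonneg _).trans (hδ i))

/-! ### Folding heights about a half-integer -/

/-- The height at distance `k + 1 / 2` from `m + 1 / 2`, above it or below it according to the
sign `s`. -/
def height (m : ℤ) (s : ℤˣ) (k : ℕ) : ℤ := if s = 1 then m + 1 + k else m - k

theorem height_one (m : ℤ) (k : ℕ) : height m 1 k = m + 1 + k := by simp [height]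

theorem height_neg_one (m : ℤ) (k : ℕ) : height m (-1) k = m - k := by
  rw [height, if_neg (by decide)]

/-- A height is determined by its distance to `m + 1 / 2` and the side on which it lies. -/
def foldEquiv (m : ℤ) : ℕ × ℤˣ ≃ ℤ where
  toFun p := height m p.2 p.1
  invFun a := if m < a then ((a - m - 1).toNat, 1) else ((m - a).toNat, -1)
  left_inv p := by
    obtain ⟨k, s⟩ := p
    rcases Int.units_eq_one_or s with rfl | rfl
    · simp only [height_one]
      rw [if_pos (by omega)]
      simp
      omega
    · simp only [height_neg_one]
      rw [if_neg (by omega)]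
      simp
  right_inv a := by
    by_cases h : m < a
    · simp only [if_pos h, height_one]
      omega
    · simp only [if_neg h, height_neg_one]
      omega

theorem tsum_eq_tsum_sum_height {V : Type*} [Fintype V] [DecidableEq V] (m : ℤ)
    (W : (V → ℤ) → ℝ≥0∞) :
    ∑' φ, W φ = ∑' k : V → ℕ, ∑ s : V → ℤˣ, W fun x => height m (s x) (k x) := by
  rw [← ((Equiv.arrowProdEquivProdArrow V (fun _ => ℕ) (fun _ => ℤˣ)).symm.trans
    (Equiv.piCongrRight fun _ => foldEquiv m)).tsum_eq, ENNReal.tsum_prod']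
  refine tsum_congr fun k => ?_
  rw [tsum_fintype]
  rfl

/-- Two heights at distances k + 1/2 and l + 1/2 from m + 1/2 differ by |k - l| when on the same
side and by k + l + 1 otherwise. Hence the edge weight takes two values according to s t, and is
affine in s t. -/
theorem exp_abs_height_sub (β : ℝ) (m : ℤ) (s t : ℤˣ) (k l : ℕ) :
    Real.exp (-β * |((height m s k : ℤ) : ℝ) - height m t l|) =
      (Real.exp (-β * |(k : ℝ) - l|) + Real.exp (-β * (k + l + 1))) / 2 +
      (Real.exp (-β * |(k : ℝ) - l|) - Real.exp (-β * (k + l + 1))) / 2 *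
        (((s * t : ℤˣ) : ℤ) : ℝ) := by
  have h1 : |(m + 1 + k : ℝ) - (m - l)| = k + l + 1 := by
    rw [abs_of_nonneg] <;> linarith [Nat.cast_nonneg (α := ℝ) k, Nat.cast_nonneg (α := ℝ) l]
  have h2 : |(m - k : ℝ) - (m + 1 + l)| = k + l + 1 := by
    rw [abs_of_nonpos] <;> linarith [Nat.cast_nonneg (α := ℝ) k, Nat.cast_nonneg (α := ℝ) l]
  have h3 : |(m + 1 + k : ℝ) - (m + 1 + l)| = |(k : ℝ) - l| := by ring_nf
  have h4 : |(m - k : ℝ) - (m - l)| = |(k : ℝ) - l| := by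
    rw [abs_sub_comm (k : ℝ)]
    ring_nf
  rcases Int.units_eq_one_or s with rfl | rfl <;> rcases Int.units_eq_one_or t with rfl | rfl <;>
    simp only [height_one, height_neg_one] <;> push_cast
  · rw [h3]; simp; ring
  · rw [h1]; simp; ring
  · rw [h2]; simp; ring
  · rw [h4]; simp; ring

theorem exp_add_le_exp_abs_sub {β : ℝ} (hβ : 0 < β) (k l : ℕ) :
    Real.exp (-β * (k + l + 1)) ≤ Real.exp (-β * |(k : ℝ) - l|) := by
  refine Real.exp_le_exp.2 ?_
  have : |(k : ℝ) - l| ≤ k + l + 1 := by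
    rw [abs_le]
    constructor <;> linarith [Nat.cast_nonneg (α := ℝ) k, Nat.cast_nonneg (α := ℝ) l]
  nlinarith

/-! ### The Ising model of the signs, and comparison of boundary conditions -/

variable {Λ : Finset (ℤ × ℤ)}

/-- The value of a sign configuration at `u`, as a character; it is trivial outside `Λ`. -/
def signAt (Λ : Finset (ℤ × ℤ)) (u : ℤ × ℤ) : (Λ → ℤˣ) →* ℤˣ :=
  if h : u ∈ Λ then Pi.evalMonoidHom (fun _ : Λ => ℤˣ) ⟨u, h⟩ else 1

/-- The weight of the configurations `φ` on `Λ` with boundary condition `a`. -/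
noncomputable def bdryWeight (Λ : Finset (ℤ × ℤ)) (β : ℝ) (a : ℤ × ℤ → ℤ) (φ : Λ → ℤ) : ℝ :=
  Real.exp (-β * energy Λ (extend φ a))

/-- At fixed distances to m + 1/2 this is an Ising weight, ferromagnetic apart from the boundary
signs. The same α and δ serve all ε, so that boundary conditions can be compared. Taking ε = 1 on Λ
makes `ε u * signAt Λ u` the sign at u both inside and outside Λ. -/
theorem bdryWeight_height (β : ℝ) (m : ℤ) (b : ℤ × ℤ → ℕ) (k : Λ → ℕ) :
    ∃ α δ : (ℤ × ℤ) × Bool → ℝ, (0 < β → ∀ e, 0 ≤ α e ∧ 0 ≤ δ e) ∧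
      ∀ ε : ℤ × ℤ → ℤˣ, (∀ x ∈ Λ, ε x = 1) → ∀ s : Λ → ℤˣ,
      bdryWeight Λ β (fun x => height m (ε x) (b x)) (fun x => height m (s x) (k x)) =
        ∏ e ∈ touching Λ, (α e + (((ε e.1 * ε (tgt e) : ℤˣ) : ℤ) : ℝ) * δ e *
          (((signAt Λ e.1 * signAt Λ (tgt e)) s : ℤ) : ℝ)) := by
  classical
  let k' : ℤ × ℤ → ℕ := fun x => if h : x ∈ Λ then k ⟨x, h⟩ else b x
  refine ⟨fun e => (Real.exp (-β * |(k' e.1 : ℝ) - k' (tgt e)|) +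
      Real.exp (-β * (k' e.1 + k' (tgt e) + 1))) / 2,
    fun e => (Real.exp (-β * |(k' e.1 : ℝ) - k' (tgt e)|) -
      Real.exp (-β * (k' e.1 + k' (tgt e) + 1))) / 2, fun hβ e => ⟨by positivity, ?_⟩, ?_⟩
  · have := exp_add_le_exp_abs_sub hβ (k' e.1) (k' (tgt e))
    simp only
    linarith
  intro ε hε s
  have hx : ∀ x, extend (fun x : Λ => height m (s x) (k x)) (fun x => height m (ε x) (b x)) x =
      height m (ε x * signAt Λ x s) (k' x) := by
    intro x
    by_cases h : x ∈ Λ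
    · simp [extend, signAt, k', h, hε x h]
    · simp [extend, signAt, k', h]
  rw [bdryWeight, energy]
  simp only [hx]
  push_cast
  rw [Finset.mul_sum, Real.exp_sum]
  refine Finset.prod_congr rfl fun e _ => ?_
  rw [exp_abs_height_sub]
  simp only [MonoidHom.mul_apply]
  push_cast
  ring

/-- Boundary signs only change the signs of the couplings, and by Griffiths' inequality the sum is
largest when all couplings are nonnegative. -/
theorem sum_bdryWeight_le {β : ℝ} (hβ : 0 < β) (m : ℤ) (ε : ℤ × ℤ → ℤˣ) (b : ℤ × ℤ → ℕ)
    (k : Λ → ℕ) :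
    ∑ s : Λ → ℤˣ, bdryWeight Λ β (fun x => height m (ε x) (b x))
        (fun x => height m (s x) (k x)) ≤
      ∑ s : Λ → ℤˣ, bdryWeight Λ β (fun x => height m 1 (b x))
        (fun x => height m (s x) (k x)) := by
  classical
  obtain ⟨α, δ, h0, h⟩ := bdryWeight_height (Λ := Λ) β m b k
  let ε' : ℤ × ℤ → ℤˣ := fun x => if x ∈ Λ then 1 else ε x
  have hext : ∀ s : Λ → ℤˣ, bdryWeight Λ β (fun x => height m (ε x) (b x))
      (fun x => height m (s x) (k x)) = bdryWeight Λ β (fun x => height m (ε' x) (b x))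
      (fun x => height m (s x) (k x)) := by
    intro s
    have : extend (fun x : Λ => height m (s x) (k x)) (fun x => height m (ε x) (b x)) =
        extend (fun x : Λ => height m (s x) (k x)) (fun x => height m (ε' x) (b x)) := by
      funext x
      by_cases hx : x ∈ Λ <;> simp [extend, hx, ε']
    rw [bdryWeight, this, bdryWeight]
  have h1 : ∀ x ∈ Λ, ε' x = 1 := fun x hx => by simp [ε', hx]
  simp only [hext, h ε' h1, h (fun _ => 1) (fun _ _ => rfl)]
  have := abs_sum_character_mul_prod_le (touching Λ)
    (fun e => signAt Λ e.1 * signAt Λ (tgt e)) α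
    (fun e => (((ε' e.1 * ε' (tgt e) : ℤˣ) : ℤ) : ℝ) * δ e) δ (fun e => (h0 hβ e).1)
    (fun e => by
      rw [abs_mul, abs_of_nonneg (h0 hβ e).2]
      rcases Int.units_eq_one_or (ε' e.1 * ε' (tgt e)) with h | h <;> simp [h]) 1
  simpa using (le_abs_self _).trans this

/-- The partition function on `Λ` with boundary condition `a`. -/
noncomputable def bdryPartition (Λ : Finset (ℤ × ℤ)) (β : ℝ) (a : ℤ × ℤ → ℤ) : ℝ≥0∞ :=
  ∑' φ : Λ → ℤ, ENNReal.ofReal (bdryWeight Λ β a φ)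

theorem bdryWeight_nonneg (β : ℝ) (a : ℤ × ℤ → ℤ) (φ : Λ → ℤ) : 0 ≤ bdryWeight Λ β a φ :=
  (Real.exp_pos _).le

/-- Reflecting the boundary values below m + 1/2 to above it makes all boundary signs plus without
changing the distances. -/
theorem bdryPartition_le_fold {β : ℝ} (hβ : 0 < β) (m : ℤ) (a : ℤ × ℤ → ℤ) :
    bdryPartition Λ β a ≤ bdryPartition Λ β fun x => max (a x) (2 * m + 1 - a x) := by
  classical
  let b : ℤ × ℤ → ℕ := fun x => ((foldEquiv m).symm (a x)).1
  let ε : ℤ × ℤ → ℤˣ := fun x => ((foldEquiv m).symm (a x)).2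
  have ha : ∀ x, a x = height m (ε x) (b x) := fun x => ((foldEquiv m).apply_symm_apply (a x)).symm
  have ha' : ∀ x, max (a x) (2 * m + 1 - a x) = height m 1 (b x) := by
    intro x
    rw [ha]
    rcases Int.units_eq_one_or (ε x) with h | h <;> simp only [h, height_one, height_neg_one] <;>
      omega
  simp only [ha']
  rw [funext ha, bdryPartition, bdryPartition, tsum_eq_tsum_sum_height m,
    tsum_eq_tsum_sum_height m]
  refine ENNReal.tsum_le_tsum fun k => ?_
  rw [← ENNReal.ofReal_sum_of_nonneg fun _ _ => bdryWeight_nonneg _ _ _,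
    ← ENNReal.ofReal_sum_of_nonneg fun _ _ => bdryWeight_nonneg _ _ _]
  exact ENNReal.ofReal_le_ofReal (sum_bdryWeight_le hβ m ε b k)

/-- Among the bounded nonpositive boundary conditions, the partition function is maximal for the
zero boundary condition. -/
theorem bdryPartition_le_zero {β : ℝ} (hβ : 0 < β) (N : ℕ) :
    ∀ a : ℤ × ℤ → ℤ, (∀ x, a x ≤ 0) → (∀ x, -(N : ℤ) ≤ a x) →
      bdryPartition Λ β a ≤ bdryPartition Λ β 0 := by
  induction N with
  | zero =>
    intro a h1 h2
    rw [show a = 0 from funext fun x => le_antisymm (h1 x) (by simpa using h2 x)]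
  | succ N ih =>
    intro a h1 h2
    -- The reflection about -N - 1/2 moves the value -(N+1) to -N and leaves the values in [-N, 0]
    -- alone.
    refine (bdryPartition_le_fold hβ (-(N : ℤ) - 1) a).trans (ih _ ?_ ?_)
    all_goals
      intro x
      have := h1 x
      have := h2 x
      push_cast at *
      omega

theorem partitionFunction_eq (Λ : Finset (ℤ × ℤ)) (β : ℝ) :
    partitionFunction Λ β = bdryPartition Λ β 0 := by
  simp only [partitionFunction, bdryPartition, weight, bdryWeight, hamiltonian_eq]

theorem weight_eq (Λ : Finset (ℤ × ℤ)) (β : ℝ) (φ : Λ → ℤ) :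
    weight Λ β φ = ENNReal.ofReal (bdryWeight Λ β 0 φ) := by
  simp only [weight, bdryWeight, hamiltonian_eq]

theorem sum_bdryWeight_le_two_pow {β : ℝ} (hβ : 0 < β) (m : ℤ) (b : ℤ × ℤ → ℕ)
    (k : Λ → ℕ) (A : Finset Λ) :
    ∑ s : Λ → ℤˣ, bdryWeight Λ β (fun x => height m 1 (b x)) (fun x => height m (s x) (k x)) ≤
      2 ^ A.card * ∑ s : Λ → ℤˣ, if ∀ x ∈ A, s x = 1 then
        bdryWeight Λ β (fun x => height m 1 (b x)) (fun x => height m (s x) (k x)) else 0 := by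
  classical
  obtain ⟨α, δ, h0, h⟩ := bdryWeight_height (Λ := Λ) β m b k
  simp only [h (fun _ => 1) (fun _ _ => rfl)]
  -- Monotonicity in the couplings, with an extra factor 1 + δ s_x for each x in `A`: δ = 0 gives
  -- the full sum, while δ = 1 gives 2^|A| times the indicator that all signs on `A` are plus.
  have := abs_sum_character_mul_prod_le ((touching Λ).disjSum A)
    (Sum.elim (fun e => signAt Λ e.1 * signAt Λ (tgt e)) fun x => signAt Λ x)
    (Sum.elim α 1) (Sum.elim δ 0) (Sum.elim δ 1) (by
      rintro (e | x)
      · exact (h0 hβ e).1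
      · simp) (by
      rintro (e | x)
      · simpa using (abs_of_nonneg (h0 hβ e).2).le
      · simp) 1
  refine le_trans (le_of_eq ?_) (((le_abs_self _).trans this).trans (le_of_eq ?_))
  · simp [Finset.prod_disjSum]
  · rw [Finset.mul_sum]
    refine Finset.sum_congr rfl fun s _ => ?_
    simp only [Finset.prod_disjSum, Sum.elim_inl, Sum.elim_inr]
    have hs : ∀ x : Λ, signAt Λ x s = s x := fun x => by simp [signAt]
    split_ifs with hA
    · rw [Finset.prod_congr rfl (g := fun _ => (2 : ℝ)) (s₁ := A) (fun x hx => by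
        rw [hs, hA x hx]; norm_num)]
      simp [mul_comm]
    · push Not at hA
      obtain ⟨x, hx, hsx⟩ := hA
      rw [Finset.prod_eq_zero (s := A) hx]
      · simp
      · rw [hs, (Int.units_eq_one_or _).resolve_left hsx]
        simp

/-- The heights on `A` are simultaneously nonnegative with probability at least `2 ^ (-|A|)`. -/
theorem partitionFunction_le_two_pow {β : ℝ} (hβ : 0 < β) (A : Finset Λ) :
    partitionFunction Λ β ≤
      2 ^ A.card * ∑' φ : Λ → ℤ, {φ : Λ → ℤ | ∀ x ∈ A, 0 ≤ φ x}.indicator (weight Λ β) φ := by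
  classical
  -- Folding about -1/2 makes the plus sign mean a nonnegative height, and the zero boundary
  -- condition has sign plus and k = 0.
  rw [partitionFunction, tsum_eq_tsum_sum_height (-1), tsum_eq_tsum_sum_height (-1),
    ← ENNReal.tsum_mul_left]
  refine ENNReal.tsum_le_tsum fun k => ?_
  have h0 : (0 : ℤ × ℤ → ℤ) = fun x => height (-1) 1 ((0 : ℤ × ℤ → ℕ) x) := by
    funext x
    simp [height_one]
  have h1 : ∀ s : Λ → ℤˣ, {φ : Λ → ℤ | ∀ x ∈ A, 0 ≤ φ x}.indicator (weight Λ β)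
      (fun x => height (-1) (s x) (k x)) = ENNReal.ofReal (if ∀ x ∈ A, s x = 1 then
        bdryWeight Λ β (fun x => height (-1) 1 ((0 : ℤ × ℤ → ℕ) x))
          (fun x => height (-1) (s x) (k x)) else 0) := by
    intro s
    have : (fun x => height (-1) (s x) (k x)) ∈ {φ : Λ → ℤ | ∀ x ∈ A, 0 ≤ φ x} ↔
        ∀ x ∈ A, s x = 1 := by
      refine forall₂_congr fun x _ => ?_
      rcases Int.units_eq_one_or (s x) with h | h <;> simp only [h, height_one, height_neg_one]
      · simp
      · simp
        omega
    rw [Set.indicator_apply, if_congr this rfl rfl, weight_eq, h0]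
    split_ifs <;> simp
  simp only [h1]
  rw [← ENNReal.ofReal_sum_of_nonneg fun s _ => by
    split_ifs
    exacts [bdryWeight_nonneg _ _ _, le_rfl]]
  simp only [weight_eq]
  rw [← ENNReal.ofReal_sum_of_nonneg fun s _ => bdryWeight_nonneg _ _ _,
    show (2 : ℝ≥0∞) ^ A.card = ENNReal.ofReal (2 ^ A.card) by
      rw [ENNReal.ofReal_pow (by norm_num)]; norm_num, ← ENNReal.ofReal_mul (by positivity)]
  refine ENNReal.ofReal_le_ofReal ?_
  rw [h0]
  exact sum_bdryWeight_le_two_pow hβ (-1) 0 k A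

end

section

variable {Λ : Finset (ℤ × ℤ)}

/-! ### Finiteness of the partition function -/

theorem tsum_fin_prod {α : Type*} (f : α → ℝ≥0∞) (n : ℕ) :
    ∑' φ : Fin n → α, ∏ i, f (φ i) = (∑' a, f a) ^ n := by
  induction n with
  | zero => simp
  | succ n ih =>
    rw [← (Fin.consEquiv fun _ : Fin (n + 1) => α).tsum_eq, ENNReal.tsum_prod', pow_succ', ← ih,
      ← ENNReal.tsum_mul_right]
    refine tsum_congr fun a => ?_
    rw [← ENNReal.tsum_mul_left]
    refine tsum_congr fun φ => ?_
    simp [Fin.consEquiv, Fin.prod_univ_succ]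

theorem tsum_pi_prod {V α : Type*} [Fintype V] (f : α → ℝ≥0∞) :
    ∑' φ : V → α, ∏ i, f (φ i) = (∑' a, f a) ^ Fintype.card V := by
  rw [← tsum_fin_prod, ← ((Fintype.equivFin V).arrowCongr (Equiv.refl α)).tsum_eq]
  refine tsum_congr fun φ => ?_
  rw [← (Fintype.equivFin V).prod_comp]
  simp

theorem abs_sub_le_sum_abs_sub (f : ℕ → ℤ) (n : ℕ) :
    |f 0 - f n| ≤ ∑ k ∈ Finset.range n, |f k - f (k + 1)| := by
  rw [← Finset.sum_range_sub' f n]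
  exact Finset.abs_sum_le_sum_abs _ _

/-- Telescoping along the horizontal path from x to the right, up to the first vertex outside Λ,
where the height is 0. -/
theorem abs_le_energy (φ : Λ → ℤ) (x : Λ) : |φ x| ≤ energy Λ (extend φ 0) := by
  classical
  have hinj : Function.Injective fun k : ℕ => (x : ℤ × ℤ) + ((k : ℤ), 0) := by
    intro k l h
    simpa using h
  have hex : ∃ n : ℕ, (x : ℤ × ℤ) + ((n : ℤ), 0) ∉ Λ := by
    by_contra! h
    exact Set.infinite_of_injective_forall_mem hinj h Λ.finite_toSet
  have h1 := abs_sub_le_sum_abs_sub (fun k : ℕ => extend φ 0 ((x : ℤ × ℤ) + ((k : ℤ), 0)))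
    (Nat.find hex)
  have h2 : extend φ 0 ((x : ℤ × ℤ) + ((Nat.find hex : ℤ), 0)) = 0 :=
    extend_of_notMem _ _ (Nat.find_spec hex)
  have h3 : extend φ 0 ((x : ℤ × ℤ) + (((0 : ℕ) : ℤ), 0)) = φ x := by
    rw [show (x : ℤ × ℤ) + (((0 : ℕ) : ℤ), (0 : ℤ)) = (x : ℤ × ℤ) by ext <;> simp, extend_coe]
  simp only [h2, h3, sub_zero] at h1
  refine h1.trans ?_
  have hinj' : Set.InjOn (fun k : ℕ => ((x : ℤ × ℤ) + ((k : ℤ), 0), false))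
      (Finset.range (Nat.find hex)) := fun k _ l _ h => hinj (congrArg Prod.fst h)
  have h4 : ∀ k ∈ Finset.range (Nat.find hex),
      |extend φ 0 ((x : ℤ × ℤ) + ((k : ℤ), 0)) - extend φ 0 ((x : ℤ × ℤ) + (((k + 1 : ℕ) : ℤ), 0))|
      = (fun e : (ℤ × ℤ) × Bool => |extend φ 0 e.1 - extend φ 0 (tgt e)|)
        ((fun k : ℕ => ((x : ℤ × ℤ) + ((k : ℤ), 0), false)) k) := by
    intro k _
    have : tgt ((x : ℤ × ℤ) + ((k : ℤ), 0), false) = (x : ℤ × ℤ) + (((k + 1 : ℕ) : ℤ), 0) := by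
      simp [tgt, unitVec, add_assoc]
    simp only [this]
  rw [energy, Finset.sum_congr rfl h4]
  refine (Finset.sum_image (f := fun e : (ℤ × ℤ) × Bool => |extend φ 0 e.1 - extend φ 0 (tgt e)|)
    hinj').symm.trans_le ?_
  refine Finset.sum_le_sum_of_subset_of_nonneg ?_ fun _ _ _ => abs_nonneg _
  intro e he
  obtain ⟨k, hk, rfl⟩ := Finset.mem_image.1 he
  refine mem_touching.2 (Or.inl ?_)
  simpa using Nat.find_min hex (Finset.mem_range.1 hk)

theorem tsum_exp_neg_abs_lt_top {c : ℝ} (hc : 0 < c) :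
    ∑' k : ℤ, ENNReal.ofReal (Real.exp (-c * |(k : ℝ)|)) < ⊤ := by
  have h : Summable fun n : ℕ => Real.exp (-c * (n : ℝ)) := by
    have := Real.summable_exp_nat_mul_iff.2 (neg_lt_zero.2 hc)
    simpa [mul_comm] using this
  have hs : Summable fun k : ℤ => Real.exp (-c * |(k : ℝ)|) := by
    refine Summable.of_nat_of_neg ?_ ?_ <;> simpa using h
  exact hs.tsum_ofReal_lt_top

theorem partitionFunction_lt_top (Λ : Finset (ℤ × ℤ)) {β : ℝ} (hβ : 0 < β) :
    partitionFunction Λ β < ⊤ := by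
  classical
  -- Each |φ x| is at most the energy, so e^(-βH) is bounded by a product of one-site weights of
  -- rate β / (|Λ| + 1). The added 1 keeps the rate defined for empty Λ.
  have hN : (0 : ℝ) < Λ.card + 1 := by positivity
  refine lt_of_le_of_lt ?_ (ENNReal.pow_lt_top (n := Fintype.card Λ)
    (tsum_exp_neg_abs_lt_top (div_pos hβ hN)))
  rw [← tsum_pi_prod, partitionFunction]
  refine ENNReal.tsum_le_tsum fun φ => ?_
  rw [weight_eq, bdryWeight, ← ENNReal.ofReal_prod_of_nonneg fun _ _ => (Real.exp_pos _).le,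
    ← Real.exp_sum]
  refine ENNReal.ofReal_le_ofReal (Real.exp_le_exp.2 ?_)
  rw [← Finset.mul_sum]
  have h : ∑ x : Λ, |(φ x : ℝ)| ≤ (Λ.card + 1) * energy Λ (extend φ 0) := by
    calc ∑ x : Λ, |(φ x : ℝ)| ≤ ∑ x : Λ, (energy Λ (extend φ 0) : ℝ) :=
          Finset.sum_le_sum fun x _ => by exact_mod_cast abs_le_energy φ x
      _ = Λ.card * energy Λ (extend φ 0) := by simp
      _ ≤ _ := by
        have : (0 : ℝ) ≤ energy Λ (extend φ 0) := by exact_mod_cast energy_nonneg _ _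
        linarith
  have h' : β / (Λ.card + 1) * ∑ x : Λ, |(φ x : ℝ)| ≤ β * energy Λ (extend φ 0) := by
    rw [div_mul_eq_mul_div, div_le_iff₀ hN]
    nlinarith
  linarith

/-! ### Probabilities as ratios of sums of weights -/

theorem partitionFunction_pos (Λ : Finset (ℤ × ℤ)) (β : ℝ) : 0 < partitionFunction Λ β :=
  lt_of_lt_of_le (ENNReal.ofReal_pos.2 (Real.exp_pos _)) (ENNReal.le_tsum 0)

theorem sosMeasure_apply (β : ℝ) (E : Set (Λ → ℤ)) :
    sosMeasure Λ β E = (partitionFunction Λ β)⁻¹ * ∑' φ, E.indicator (weight Λ β) φ := by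
  have hE : MeasurableSet E := E.to_countable.measurableSet
  rw [sosMeasure, Measure.smul_apply, Measure.sum_apply _ hE, smul_eq_mul]
  congr 1
  refine tsum_congr fun φ => ?_
  rw [Measure.smul_apply, Measure.dirac_apply' _ hE]
  by_cases h : φ ∈ E <;> simp [h]

theorem sosMeasure_real_le {β : ℝ} (hβ : 0 < β) {E : Set (Λ → ℤ)} {c : ℝ} (hc : 0 ≤ c)
    (h : ∑' φ, E.indicator (weight Λ β) φ ≤ ENNReal.ofReal c * partitionFunction Λ β) :
    (sosMeasure Λ β).real E ≤ c := by
  refine ENNReal.toReal_le_of_le_ofReal hc ?_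
  rw [sosMeasure_apply]
  calc _ ≤ (partitionFunction Λ β)⁻¹ * (ENNReal.ofReal c * partitionFunction Λ β) := by gcongr
    _ = ENNReal.ofReal c := by
      rw [mul_comm, mul_assoc, ENNReal.mul_inv_cancel (partitionFunction_pos Λ β).ne'
        (partitionFunction_lt_top Λ hβ).ne, mul_one]

theorem le_sosMeasure_real {β : ℝ} (hβ : 0 < β) {E : Set (Λ → ℤ)} {c : ℝ}
    (h : ENNReal.ofReal c * partitionFunction Λ β ≤ ∑' φ, E.indicator (weight Λ β) φ) :
    c ≤ (sosMeasure Λ β).real E := by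
  have hfin : sosMeasure Λ β E ≠ ⊤ := by
    rw [sosMeasure_apply]
    refine ENNReal.mul_ne_top (ENNReal.inv_ne_top.2 (partitionFunction_pos Λ β).ne') ?_
    exact ((ENNReal.tsum_le_tsum fun φ => Set.indicator_le_self _ _ φ).trans_lt
      (partitionFunction_lt_top Λ hβ)).ne
  refine (ENNReal.ofReal_le_iff_le_toReal hfin).1 ?_
  rw [sosMeasure_apply]
  calc ENNReal.ofReal c
      _ = (partitionFunction Λ β)⁻¹ * (ENNReal.ofReal c * partitionFunction Λ β) := by
        rw [mul_comm, mul_assoc, ENNReal.mul_inv_cancel (partitionFunction_pos Λ β).ne'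
          (partitionFunction_lt_top Λ hβ).ne, mul_one]
      _ ≤ _ := by gcongr

/-! ### Lower bounds -/

open Classical in
-- The vertices of `A` have 4|A| edge ends in total; an edge within `A` uses up two of them without
-- contributing to the perimeter.
theorem sum_abs_indicator_sub_le (A : Finset Λ) (F : Finset ((ℤ × ℤ) × Bool))
    (hF : ∀ e ∈ F, e.1 ∈ A.image Subtype.val ∧ tgt e ∈ A.image Subtype.val) :
    ∑ e ∈ touching Λ, |(if e.1 ∈ A.image Subtype.val then 1 else 0 : ℤ) -
      (if tgt e ∈ A.image Subtype.val then 1 else 0)| + 2 * F.card ≤ 4 * A.card := by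
  have hsub : A.image Subtype.val ⊆ Λ := by
    intro x hx
    obtain ⟨y, _, rfl⟩ := Finset.mem_image.1 hx
    exact y.2
  have hFsub : F ⊆ touching Λ := fun e he => mem_touching.2 (Or.inl (hsub (hF e he).1))
  have h2 : (F.card : ℤ) = ∑ e ∈ touching Λ, if e ∈ F then 1 else 0 := by
    rw [← Finset.sum_filter, Finset.sum_const, Finset.filter_mem_eq_inter,
      Finset.inter_eq_right.2 hFsub]
    simp
  have hcard : (A.image Subtype.val).card = A.card :=
    Finset.card_image_of_injective _ Subtype.val_injective
  have h4 : (4 * A.card : ℤ) = ∑ e ∈ touching Λ, ((if e.1 ∈ A.image Subtype.val then 1 else 0) +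
      (if tgt e ∈ A.image Subtype.val then 1 else 0)) := by
    rw [Finset.sum_add_distrib, ← Finset.sum_filter, ← Finset.sum_filter,
      sum_touching_fst hsub, sum_touching_tgt hsub]
    simp [hcard]
    ring
  rw [h2, h4, Finset.mul_sum, ← Finset.sum_add_distrib]
  refine Finset.sum_le_sum fun e _ => ?_
  have := hF e
  split_ifs <;> simp_all

theorem le_sosMeasure_real_forall {β : ℝ} (hβ : 0 < β) (n : ℕ) (A : Finset Λ)
    (F : Finset ((ℤ × ℤ) × Bool)) (p : ℕ) (hp : 4 * A.card ≤ p + 2 * F.card)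
    (hF : ∀ e ∈ F, e.1 ∈ A.image Subtype.val ∧ tgt e ∈ A.image Subtype.val) :
    (1 / 2) ^ A.card * Real.exp (-p * β * n) ≤
      (sosMeasure Λ β).real {φ | ∀ x ∈ A, (n : ℤ) ≤ φ x} := by
  classical
  refine le_sosMeasure_real hβ ?_
  have hshift : ∑' φ : Λ → ℤ, {φ : Λ → ℤ | ∀ x ∈ A, 0 ≤ φ x}.indicator (weight Λ β) φ ≤
      ENNReal.ofReal (Real.exp (p * β * n)) *
        ∑' φ : Λ → ℤ, {φ : Λ → ℤ | ∀ x ∈ A, (n : ℤ) ≤ φ x}.indicator (weight Λ β) φ := by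
    -- The shift by `u` is a bijection of configurations which raises the energy by at most n times
    -- the perimeter of `A`.
    let u : Λ → ℤ := fun x => if x ∈ A then n else 0
    rw [← (Equiv.addRight u).tsum_eq fun φ : Λ → ℤ =>
      {φ : Λ → ℤ | ∀ x ∈ A, (n : ℤ) ≤ φ x}.indicator (weight Λ β) φ, ← ENNReal.tsum_mul_left]
    refine ENNReal.tsum_le_tsum fun φ => ?_
    by_cases hφ : ∀ x ∈ A, 0 ≤ φ x
    · have hφ' : Equiv.addRight u φ ∈ {φ : Λ → ℤ | ∀ x ∈ A, (n : ℤ) ≤ φ x} := by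
        intro x hx
        simpa [u, hx] using hφ x hx
      rw [Set.indicator_of_mem (by exact hφ), Set.indicator_of_mem hφ', weight_eq, weight_eq,
        bdryWeight, bdryWeight, ← ENNReal.ofReal_mul (Real.exp_pos _).le, ← Real.exp_add]
      refine ENNReal.ofReal_le_ofReal (Real.exp_le_exp.2 ?_)
      have hE : energy Λ (extend (Equiv.addRight u φ) 0) ≤ energy Λ (extend φ 0) + n * p := by
        have h1 := sum_abs_indicator_sub_le A F hF
        have h2 : energy Λ (extend (Equiv.addRight u φ) 0) ≤ energy Λ (extend φ 0) + n *
            ∑ e ∈ touching Λ, |(if e.1 ∈ A.image Subtype.val then 1 else 0 : ℤ) -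
            (if tgt e ∈ A.image Subtype.val then 1 else 0)| := by
          rw [energy, energy, Finset.mul_sum, ← Finset.sum_add_distrib]
          refine Finset.sum_le_sum fun e _ => ?_
          have h3 : ∀ y, extend (Equiv.addRight u φ) 0 y = extend φ 0 y +
              n * (if y ∈ A.image Subtype.val then 1 else 0) := by
            intro y
            by_cases hy : y ∈ Λ
            · simp [extend, hy, u]
            · simp [extend, hy]
          rw [h3, h3]
          rw [show ∀ a b c d : ℤ, a + n * b - (c + n * d) = (a - c) + n * (b - d) by
            intros; ring]
          refine (abs_add_le _ _).trans (le_of_eq ?_)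
          rw [abs_mul, Nat.abs_cast]
        have h3 : ∑ e ∈ touching Λ, |(if e.1 ∈ A.image Subtype.val then 1 else 0 : ℤ) -
            (if tgt e ∈ A.image Subtype.val then 1 else 0)| ≤ p := by omega
        exact h2.trans (by gcongr)
      have hE' : (energy Λ (extend (Equiv.addRight u φ) 0) : ℝ) ≤
          energy Λ (extend φ 0) + n * p := by exact_mod_cast hE
      nlinarith
    · rw [Set.indicator_of_notMem (by exact hφ)]
      exact zero_le
  calc _ ≤ ENNReal.ofReal ((1 / 2) ^ A.card * Real.exp (-p * β * n)) * (2 ^ A.card *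
        (ENNReal.ofReal (Real.exp (p * β * n)) *
        ∑' φ : Λ → ℤ, {φ : Λ → ℤ | ∀ x ∈ A, (n : ℤ) ≤ φ x}.indicator (weight Λ β) φ)) := by
        gcongr
        exact (partitionFunction_le_two_pow hβ A).trans (by gcongr)
    _ = _ := by
      rw [show (2 : ℝ≥0∞) ^ A.card = ENNReal.ofReal (2 ^ A.card) by
        rw [ENNReal.ofReal_pow (by norm_num)]; norm_num, ← mul_assoc, ← mul_assoc,
        ← ENNReal.ofReal_mul (by positivity), ← ENNReal.ofReal_mul (by positivity)]
      rw [show (1 / 2 : ℝ) ^ A.card * Real.exp (-p * β * n) * 2 ^ A.card *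
          Real.exp (p * β * n) = ((1 / 2) ^ A.card * 2 ^ A.card) *
          (Real.exp (-p * β * n) * Real.exp (p * β * n)) by ring, ← mul_pow, ← Real.exp_add]
      simp

end

section

/-! ### Boundary darts of a finite set and their linking permutation -/

/-- The four lattice directions. -/
inductive Dir where
  | east
  | north
  | west
  | south
deriving DecidableEq

/-- The other end point of the dart `d`, which starts at `d.1` in direction `d.2`. -/
def right : (ℤ × ℤ) × Dir → ℤ × ℤ
  | ((a, b), .east) => (a + 1, b)
  | ((a, b), .north) => (a, b + 1)
  | ((a, b), .west) => (a - 1, b)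
  | ((a, b), .south) => (a, b - 1)

/-- The dual edge crossed by a dart `d` is oriented so as to have `d.1` on its left; this is its
final dual vertex. -/
def head : (ℤ × ℤ) × Dir → ℤ × ℤ
  | ((a, b), .east) => (a, b)
  | ((a, b), .north) => (a - 1, b)
  | ((a, b), .west) => (a - 1, b - 1)
  | ((a, b), .south) => (a, b - 1)

/-- The initial dual vertex of the oriented dual edge crossed by a dart. -/
def tail : (ℤ × ℤ) × Dir → ℤ × ℤ
  | ((a, b), .east) => (a, b - 1)
  | ((a, b), .north) => (a, b)
  | ((a, b), .west) => (a - 1, b)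
  | ((a, b), .south) => (a - 1, b - 1)

/-- The dual edge crossed by a dart. -/
def dartEdge (d : (ℤ × ℤ) × Dir) : Sym2 (ℤ × ℤ) := s(tail d, head d)

/-- `d` leads out of `S`. -/
def IsBd (S : Finset (ℤ × ℤ)) (d : (ℤ × ℤ) × Dir) : Prop := d.1 ∈ S ∧ right d ∉ S

/-- The boundary dart that follows a boundary dart of `S` on the boundary of `S`. Where four
boundary edges meet, the linked ones follow each other. -/
def next (S : Finset (ℤ × ℤ)) : (ℤ × ℤ) × Dir → (ℤ × ℤ) × Dir
  | ((a, b), .east) =>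
    if (a + 1, b + 1) ∈ S then ((a + 1, b + 1), .south)
    else if (a, b + 1) ∈ S then ((a, b + 1), .east) else ((a, b), .north)
  | ((a, b), .north) =>
    if (a - 1, b) ∉ S then ((a, b), .west)
    else if (a - 1, b + 1) ∈ S then ((a - 1, b + 1), .east) else ((a - 1, b), .north)
  | ((a, b), .west) =>
    if (a - 1, b - 1) ∈ S then ((a - 1, b - 1), .north)
    else if (a, b - 1) ∈ S then ((a, b - 1), .west) else ((a, b), .south)
  | ((a, b), .south) =>
    if (a + 1, b) ∉ S then ((a, b), .east)
    else if (a + 1, b - 1) ∈ S then ((a + 1, b - 1), .west) else ((a + 1, b), .south)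

variable {S : Finset (ℤ × ℤ)}

theorem tail_next (d : (ℤ × ℤ) × Dir) : tail (next S d) = head d := by
  obtain ⟨⟨a, b⟩, i⟩ := d
  cases i <;> simp only [next] <;> split_ifs <;> simp [tail, head]

theorem IsBd.next {d : (ℤ × ℤ) × Dir} (h : IsBd S d) : IsBd S (next S d) := by
  obtain ⟨⟨a, b⟩, i⟩ := d
  unfold IsBd at *
  cases i <;> simp only [SOS.next, right] at * <;> split_ifs <;> simp_all

theorem head_ne_tail (d : (ℤ × ℤ) × Dir) : head d ≠ tail d := by
  obtain ⟨⟨a, b⟩, i⟩ := d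
  cases i <;> simp only [head, tail, ne_eq, Prod.mk.injEq] <;> omega

theorem head_next_ne_tail (d : (ℤ × ℤ) × Dir) : head (next S d) ≠ tail d := by
  obtain ⟨⟨a, b⟩, i⟩ := d
  cases i <;> simp only [next] <;> split_ifs <;>
    simp only [head, tail, ne_eq, Prod.mk.injEq] <;> omega

/-- Only a dart and its reversal cross the same dual edge, and they cannot both lead out of `S`. -/
theorem dartEdge_injOn {d d' : (ℤ × ℤ) × Dir} (h : IsBd S d) (h' : IsBd S d')
    (he : dartEdge d = dartEdge d') : d = d' := by
  obtain ⟨⟨a, b⟩, i⟩ := d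
  obtain ⟨⟨a', b'⟩, i'⟩ := d'
  unfold IsBd at *
  cases i <;> cases i' <;>
    simp only [dartEdge, tail, head, right, Sym2.eq_iff, Prod.mk.injEq, and_true, reduceCtorEq,
      and_false] at * <;> first | omega | grind

theorem next_injOn {d d' : (ℤ × ℤ) × Dir} (h : IsBd S d) (h' : IsBd S d')
    (he : next S d = next S d') : d = d' := by
  have ht : head d = head d' := by rw [← tail_next (S := S), he, tail_next]
  obtain ⟨⟨a, b⟩, i⟩ := d
  obtain ⟨⟨a', b'⟩, i'⟩ := d'
  unfold IsBd at *
  cases i <;> cases i' <;> simp only [head, right, next, Prod.mk.injEq] at * <;> grind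

/-- A second boundary dart with the same head forces the four vertices around that dual vertex to be
alternately in and out of `S`. There `next` joins the two diagonal vertices of `S` if they lie along
the π/4 direction and separates them otherwise; either way the turn stays on one side of the π/4
line. -/
theorem linkedAt_next {d d' : (ℤ × ℤ) × Dir} (h : IsBd S d) (h' : IsBd S d') (hne : d ≠ d')
    (ht : head d = head d') : LinkedAt (head d) (dartEdge d) (dartEdge (next S d)) := by
  refine ⟨tail d, head (next S d), ?_, ?_, ?_, Sym2.eq_swap, ?_, ?_⟩
  · obtain ⟨⟨a, b⟩, i⟩ := d
    cases i <;> simp [head, tail, Adj]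
  · rw [← tail_next (S := S)]
    generalize next S d = d
    obtain ⟨⟨a, b⟩, i⟩ := d
    cases i <;> simp [head, tail, Adj]
  · exact (head_next_ne_tail d).symm
  · rw [dartEdge, tail_next]
  · obtain ⟨⟨a, b⟩, i⟩ := d
    obtain ⟨⟨a', b'⟩, i'⟩ := d'
    unfold IsBd at *
    cases i <;> cases i' <;> simp only [head, right, next, side, tail, Prod.mk.injEq] at * <;> grind

end

section

variable {S : Finset (ℤ × ℤ)}

open Classical in
/-- The boundary darts of `S`. -/
noncomputable def bdDarts (S : Finset (ℤ × ℤ)) : Finset ((ℤ × ℤ) × Dir) :=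
  (S ×ˢ {Dir.east, Dir.north, Dir.west, Dir.south}).filter (IsBd S)

theorem mem_bdDarts {d : (ℤ × ℤ) × Dir} : d ∈ bdDarts S ↔ IsBd S d := by
  obtain ⟨u, i⟩ := d
  simp only [bdDarts, Finset.mem_filter, Finset.mem_product, Finset.mem_insert,
    Finset.mem_singleton, and_iff_right_iff_imp]
  intro h
  refine ⟨h.1, ?_⟩
  cases i <;> simp

/-- The permutation of the boundary darts that follows the boundary. -/
noncomputable def nextPerm (S : Finset (ℤ × ℤ)) : Equiv.Perm (bdDarts S) :=
  Equiv.ofBijective (fun d => ⟨next S d, mem_bdDarts.2 (mem_bdDarts.1 d.2).next⟩)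
    (Finite.injective_iff_bijective.1 fun d d' h => Subtype.ext
      (next_injOn (mem_bdDarts.1 d.2) (mem_bdDarts.1 d'.2) (congrArg Subtype.val h)))

theorem coe_nextPerm (d : bdDarts S) : (nextPerm S d : (ℤ × ℤ) × Dir) = next S d := rfl

open Classical in
/-- The boundary darts which lie on the same boundary curve as `d`. -/
noncomputable def orbit (d : bdDarts S) : Finset ((ℤ × ℤ) × Dir) :=
  (Finset.univ.filter ((nextPerm S).SameCycle d)).map (Function.Embedding.subtype _)

theorem coe_mem_orbit {d d' : bdDarts S} : (d' : (ℤ × ℤ) × Dir) ∈ orbit d ↔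
    (nextPerm S).SameCycle d d' := by
  simp [orbit]

theorem orbit_subset (d : bdDarts S) : orbit d ⊆ bdDarts S := by
  intro x hx
  obtain ⟨y, _, rfl⟩ := Finset.mem_map.1 hx
  exact y.2

theorem orbit_eq_iff {d d' : bdDarts S} : orbit d = orbit d' ↔ (nextPerm S).SameCycle d d' := by
  constructor
  · intro h
    rw [← coe_mem_orbit, h, coe_mem_orbit]
  · intro h
    refine congrArg (Finset.map _) (Finset.filter_congr fun x _ => ?_)
    exact ⟨fun hx => h.symm.trans hx, fun hx => h.trans hx⟩

theorem next_mem_orbit (d : bdDarts S) {x : (ℤ × ℤ) × Dir} (hx : x ∈ orbit d) :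
    next S x ∈ orbit d := by
  lift x to bdDarts S using orbit_subset d hx
  rw [← coe_nextPerm, coe_mem_orbit, Equiv.Perm.sameCycle_apply_right]
  exact coe_mem_orbit.1 hx

theorem orbit_induction (d : bdDarts S) {P : (ℤ × ℤ) × Dir → Prop} (h0 : P d)
    (hs : ∀ x ∈ orbit d, P x → P (next S x)) {x : (ℤ × ℤ) × Dir} (hx : x ∈ orbit d) : P x := by
  lift x to bdDarts S using orbit_subset d hx
  obtain ⟨i, rfl⟩ := (coe_mem_orbit.1 hx).exists_nat_pow_eq
  clear hx
  induction i with
  | zero => simpa using h0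
  | succ i ih =>
    rw [pow_succ', Equiv.Perm.mul_apply, coe_nextPerm]
    exact hs _ (coe_mem_orbit.2 (Equiv.Perm.sameCycle_pow_right.2 (Equiv.Perm.SameCycle.refl _ _)))
      ih

/-! ### Boundary curves are geometric contours -/

/-- The dual edges crossed by a set of darts. -/
def dartEdges (O : Finset ((ℤ × ℤ) × Dir)) : Finset (Sym2 (ℤ × ℤ)) := O.image dartEdge

theorem isDualEdge_dartEdge (d : (ℤ × ℤ) × Dir) : IsDualEdge (dartEdge d) := by
  refine ⟨tail d, head d, ?_, rfl⟩
  obtain ⟨⟨a, b⟩, i⟩ := d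
  cases i <;> simp [head, tail, Adj]

theorem next_next_ne (d : (ℤ × ℤ) × Dir) : next S (next S d) ≠ d := by
  intro h
  have := tail_next (S := S) (next S d)
  rw [h] at this
  exact head_next_ne_tail d this.symm

theorem eq_head_of_mem {d : (ℤ × ℤ) × Dir} {p : ℤ × ℤ} (h : p ∈ dartEdge d)
    (h' : p ∈ dartEdge (next S d)) : p = head d := by
  rw [dartEdge, Sym2.mem_iff] at h h'
  rcases h with rfl | h
  · rcases h' with h' | h'
    · rw [h', tail_next]
    · exact absurd h'.symm (head_next_ne_tail d)
  · exact h

/-- The orbit is listed by iterating `next` over its period n. Periods 1 and 2 are impossible, since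
they would make the curve stand still or turn back along the same dual edge. -/
theorem isGeometricContour_orbit (d : bdDarts S) : IsGeometricContour (dartEdges (orbit d)) := by
  classical
  let f : bdDarts S → bdDarts S := nextPerm S
  have hf : ∀ k (x : bdDarts S), f^[k] x = ((nextPerm S) ^ k) x := fun k x => by
    rw [Equiv.Perm.iterate_eq_pow]
  set n := Function.minimalPeriod f d with hn
  have hn0 : 0 < n := by
    refine Function.minimalPeriod_pos_of_mem_periodicPts ⟨orderOf (nextPerm S), orderOf_pos _, ?_⟩
    rw [Function.IsPeriodicPt, Function.IsFixedPt, hf, pow_orderOf_eq_one]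
    rfl
  have hper : f^[n] d = d := Function.iterate_minimalPeriod
  have hne1 : n ≠ 1 := by
    intro h
    rw [h] at hper
    have h1 : next S d = d := congrArg Subtype.val hper
    have := tail_next (S := S) d
    rw [h1] at this
    exact head_ne_tail _ this.symm
  have hne2 : n ≠ 2 := by
    intro h
    rw [h] at hper
    exact next_next_ne _ (congrArg Subtype.val hper)
  have : NeZero n := ⟨hn0.ne'⟩
  have : Fact (1 < n) := ⟨by omega⟩
  let D : ZMod n → bdDarts S := fun i => f^[i.val] d
  have hD : ∀ i, (D (i + 1) : (ℤ × ℤ) × Dir) = next S (D i) := by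
    intro i
    have : D (i + 1) = f (D i) := by
      simp only [D]
      rw [ZMod.val_add, ZMod.val_one, Function.iterate_mod_minimalPeriod_eq,
        Function.iterate_succ_apply']
    rw [this]
    rfl
  have hbd : ∀ i, IsBd S (D i) := fun i => mem_bdDarts.1 (D i).2
  have hinj : Function.Injective D := by
    intro i j hij
    exact ZMod.val_injective n (Function.iterate_injOn_Iio_minimalPeriod (ZMod.val_lt i)
      (ZMod.val_lt j) hij)
  refine ⟨n, fun i => dartEdge (D i), ⟨by omega, fun i => isDualEdge_dartEdge _, ?_, ?_, ?_⟩, ?_⟩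
  · intro i j hij
    exact hinj (Subtype.ext (dartEdge_injOn (hbd i) (hbd j) hij))
  · intro i
    refine ⟨head (D i), by simp [dartEdge], ?_⟩
    rw [hD, dartEdge, tail_next]
    simp
  · intro i j hij p hi hi' hj hj'
    rw [hD] at hi' hj' ⊢
    rw [hD]
    have h1 := eq_head_of_mem hi hi'
    have h2 := eq_head_of_mem hj hj'
    have hne : (D i : (ℤ × ℤ) × Dir) ≠ D j := fun h => hij (hinj (Subtype.ext h))
    have hh : head (D i) = head (D j) := h1.symm.trans h2
    exact ⟨h1 ▸ linkedAt_next (hbd i) (hbd j) hne hh,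
      h2 ▸ linkedAt_next (hbd j) (hbd i) hne.symm hh.symm⟩
  · ext e
    simp only [dartEdges, Finset.coe_image, Set.mem_image, Finset.mem_coe, Set.mem_range]
    constructor
    · rintro ⟨x, hx, rfl⟩
      lift x to bdDarts S using orbit_subset d hx
      obtain ⟨k, rfl⟩ := (coe_mem_orbit.1 hx).exists_nat_pow_eq
      refine ⟨(k : ZMod n), ?_⟩
      simp only [D]
      rw [ZMod.val_natCast, Function.iterate_mod_minimalPeriod_eq, hf]
    · rintro ⟨i, rfl⟩
      refine ⟨D i, coe_mem_orbit.2 ?_, rfl⟩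
      simp only [D, hf]
      exact Equiv.Perm.sameCycle_pow_right.2 (Equiv.Perm.SameCycle.refl _ _)

/-! ### Winding numbers -/

/-- The sign with which a dart crosses the horizontal half-line from `x` to the right. -/
def raySign (x : ℤ × ℤ) : (ℤ × ℤ) × Dir → ℤ
  | ((a, b), .east) => if b = x.2 ∧ x.1 ≤ a then 1 else 0
  | ((a, b), .west) => if b = x.2 ∧ x.1 ≤ a - 1 then -1 else 0
  | _ => 0

/-- The winding number of a set of darts around `x`. -/
def winding (O : Finset ((ℤ × ℤ) × Dir)) (x : ℤ × ℤ) : ℤ := ∑ d ∈ O, raySign x d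

/-- The dart along a nearest-neighbour edge, in the positive direction. -/
def fwd (e : (ℤ × ℤ) × Bool) : (ℤ × ℤ) × Dir := (e.1, bif e.2 then .north else .east)

/-- The dart along a nearest-neighbour edge, in the negative direction. -/
def bwd (e : (ℤ × ℤ) × Bool) : (ℤ × ℤ) × Dir := (tgt e, bif e.2 then .south else .west)

theorem right_fwd (e : (ℤ × ℤ) × Bool) : right (fwd e) = tgt e := by
  obtain ⟨⟨a, b⟩, i⟩ := e
  cases i <;> simp [fwd, right, tgt, unitVec]

theorem right_bwd (e : (ℤ × ℤ) × Bool) : right (bwd e) = e.1 := by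
  obtain ⟨⟨a, b⟩, i⟩ := e
  cases i <;> simp [bwd, right, tgt, unitVec]

theorem dartEdge_eq_dualEdge_iff {d : (ℤ × ℤ) × Dir} {e : (ℤ × ℤ) × Bool} :
    dartEdge d = dualEdge e ↔ d = fwd e ∨ d = bwd e := by
  obtain ⟨⟨a, b⟩, i⟩ := d
  obtain ⟨⟨a', b'⟩, j⟩ := e
  cases i <;> cases j <;>
    simp [dartEdge, tail, head, dualEdge, crossingEdge, fwd, bwd, tgt, unitVec] <;> omega

theorem winding_sub_false (O : Finset ((ℤ × ℤ) × Dir)) (u : ℤ × ℤ) :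
    winding O u - winding O (tgt (u, false)) =
      (if fwd (u, false) ∈ O then 1 else 0) - (if bwd (u, false) ∈ O then 1 else 0) := by
  rw [winding, winding, ← Finset.sum_sub_distrib,
    ← Finset.sum_ite_eq' O (fwd (u, false)) fun _ => (1 : ℤ),
    ← Finset.sum_ite_eq' O (bwd (u, false)) fun _ => (1 : ℤ), ← Finset.sum_sub_distrib]
  refine Finset.sum_congr rfl fun d _ => ?_
  obtain ⟨⟨a, b⟩, i⟩ := d
  obtain ⟨c, r⟩ := u
  cases i <;> simp [raySign, fwd, bwd, tgt, unitVec] <;> grind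

/-- Unlike a horizontal move, a vertical move of x displaces the whole half-line, so this needs the
curves to be closed: what crosses only one of the two half-lines enters or leaves the half-line of
dual vertices between them, and the net flow there is zero. -/
theorem winding_sub_true {O : Finset ((ℤ × ℤ) × Dir)} (hO : O ⊆ bdDarts S)
    (hn : ∀ d ∈ O, next S d ∈ O) (u : ℤ × ℤ) :
    winding O u - winding O (tgt (u, true)) =
      (if fwd (u, true) ∈ O then 1 else 0) - (if bwd (u, true) ∈ O then 1 else 0) := by
  have himage : O.image (next S) = O := by
    refine Finset.eq_of_subset_of_card_le (Finset.image_subset_iff.2 hn) ?_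
    rw [Finset.card_image_of_injOn]
    exact fun d hd d' hd' h =>
      next_injOn (mem_bdDarts.1 (hO hd)) (mem_bdDarts.1 (hO hd')) h
  -- `next` permutes `O` and carries heads to tails.
  have hflow : ∀ ψ : ℤ × ℤ → ℤ, ∑ d ∈ O, (ψ (head d) - ψ (tail d)) = 0 := by
    intro ψ
    rw [Finset.sum_sub_distrib, sub_eq_zero]
    conv_rhs => rw [← himage]
    rw [Finset.sum_image fun d hd d' hd' h =>
      next_injOn (mem_bdDarts.1 (hO hd)) (mem_bdDarts.1 (hO hd')) h]
    simp only [tail_next]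
  have hpoint : ∀ d, raySign u d - raySign (tgt (u, true)) d =
      ((if d = fwd (u, true) then 1 else 0) - (if d = bwd (u, true) then 1 else 0)) +
      ((if (head d).2 = u.2 ∧ u.1 ≤ (head d).1 then 1 else 0) -
        (if (tail d).2 = u.2 ∧ u.1 ≤ (tail d).1 then 1 else 0)) := by
    intro d
    obtain ⟨⟨a, b⟩, i⟩ := d
    obtain ⟨c, r⟩ := u
    cases i <;> simp [raySign, fwd, bwd, tgt, unitVec, head, tail] <;> grind
  rw [winding, winding, ← Finset.sum_sub_distrib, Finset.sum_congr rfl fun d _ => hpoint d,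
    Finset.sum_add_distrib, hflow fun p => if p.2 = u.2 ∧ u.1 ≤ p.1 then 1 else 0, add_zero,
    Finset.sum_sub_distrib, Finset.sum_ite_eq', Finset.sum_ite_eq']

theorem winding_sub {O : Finset ((ℤ × ℤ) × Dir)} (hO : O ⊆ bdDarts S)
    (hn : ∀ d ∈ O, next S d ∈ O) (e : (ℤ × ℤ) × Bool) :
    winding O e.1 - winding O (tgt e) =
      (if fwd e ∈ O then 1 else 0) - (if bwd e ∈ O then 1 else 0) := by
  obtain ⟨u, i⟩ := e
  cases i
  · exact winding_sub_false O u
  · exact winding_sub_true hO hn u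

theorem exists_winding_eq_zero (O : Finset ((ℤ × ℤ) × Dir)) :
    ∃ N : ℤ, ∀ x : ℤ × ℤ, N ≤ x.1 → winding O x = 0 := by
  obtain ⟨N, hN⟩ := (O.image fun d => d.1.1).bddAbove
  refine ⟨N + 1, fun x hx => Finset.sum_eq_zero fun d hd => ?_⟩
  have h : d.1.1 ≤ N := hN (Finset.mem_coe.2 (Finset.mem_image_of_mem _ hd))
  obtain ⟨⟨a, b⟩, i⟩ := d
  simp only at h
  cases i <;> simp [raySign] <;> omega

/-- A function that vanishes far to the right is determined by its horizontal differences. -/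
theorem eq_of_horizontal_sub_eq {f g : ℤ × ℤ → ℤ} {N : ℤ}
    (h : ∀ u, f u - f (tgt (u, false)) = g u - g (tgt (u, false)))
    (hf : ∀ x : ℤ × ℤ, N ≤ x.1 → f x = g x) : f = g := by
  have key : ∀ n : ℕ, ∀ x : ℤ × ℤ, N ≤ x.1 + n → f x = g x := by
    intro n
    induction n with
    | zero => intro x hx; exact hf x (by simpa using hx)
    | succ n ih =>
      intro x hx
      have h1 := h x
      have h2 := ih (tgt (x, false)) (by simp [tgt, unitVec]; push_cast at hx; omega)
      omega
  funext x
  exact key (N - x.1).toNat x (by omega)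

open Classical in
-- Both sides vanish far to the right and jump alike across each horizontal edge.
theorem winding_bdDarts (S : Finset (ℤ × ℤ)) :
    winding (bdDarts S) = fun x => if x ∈ S then 1 else 0 := by
  obtain ⟨N, hN⟩ := exists_winding_eq_zero (bdDarts S)
  obtain ⟨M, hM⟩ := (S.image Prod.fst).bddAbove
  refine eq_of_horizontal_sub_eq (N := max N (M + 1)) (fun u => ?_) fun x hx => ?_
  · rw [winding_sub_false]
    simp only [mem_bdDarts, IsBd, right_fwd, right_bwd]
    by_cases h1 : u ∈ S <;> by_cases h2 : tgt (u, false) ∈ S <;> simp [h1, h2, fwd, bwd]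
  · rw [hN x (by omega), if_neg]
    intro h
    have : x.1 ≤ M := hM (Finset.mem_coe.2 (Finset.mem_image_of_mem _ h))
    omega

/-! ### The interior of a boundary curve -/

open Classical in
/-- The vertices enclosed by a set of dual edges, according to the even-odd rule. -/
def inside (γ : Finset (Sym2 (ℤ × ℤ))) : Set (ℤ × ℤ) :=
  {x | Odd (γ.filter fun e => ∃ k : ℕ, e = crossingEdge (x.1 + k) x.2).card}

theorem ray_iff {x : ℤ × ℤ} {d : (ℤ × ℤ) × Dir} :
    (∃ k : ℕ, dartEdge d = crossingEdge (x.1 + k) x.2) ↔ raySign x d ≠ 0 := by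
  have h : ∀ k : ℕ, crossingEdge (x.1 + k) x.2 = dualEdge ((x.1 + k, x.2), false) := fun _ => rfl
  simp only [h, dartEdge_eq_dualEdge_iff]
  obtain ⟨⟨a, b⟩, i⟩ := d
  cases i <;> simp only [fwd, bwd, tgt, unitVec, raySign, Prod.mk.injEq, cond_false, reduceCtorEq,
    and_false, or_false, false_or, exists_false, ne_eq, not_true_eq_false, and_true,
    Prod.mk_add_mk, ite_eq_right_iff, one_ne_zero, imp_false, not_not, neg_eq_zero, add_zero]
  · exact ⟨fun ⟨k, h1, h2⟩ => ⟨h2, by omega⟩, fun ⟨h1, h2⟩ => ⟨(a - x.1).toNat, by omega, h1⟩⟩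
  · exact ⟨fun ⟨k, h1, h2⟩ => ⟨h2, by omega⟩, fun ⟨h1, h2⟩ => ⟨(a - 1 - x.1).toNat, by omega, h1⟩⟩

/-- Distinct boundary darts cross distinct dual edges, and modulo 2 a signed crossing counts as a
crossing. -/
theorem mem_inside_iff_odd_winding {O : Finset ((ℤ × ℤ) × Dir)} (hO : O ⊆ bdDarts S)
    (x : ℤ × ℤ) : x ∈ inside (dartEdges O) ↔ Odd (winding O x) := by
  classical
  have hinj : Set.InjOn dartEdge (O : Set ((ℤ × ℤ) × Dir)) := fun d hd d' hd' h =>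
    dartEdge_injOn (mem_bdDarts.1 (hO hd)) (mem_bdDarts.1 (hO hd')) h
  have h1 : ((dartEdges O).filter fun e => ∃ k : ℕ, e = crossingEdge (x.1 + k) x.2).card =
      (O.filter fun d => raySign x d ≠ 0).card := by
    rw [dartEdges, Finset.filter_image, Finset.card_image_of_injOn (hinj.mono (Finset.coe_subset.2 (Finset.filter_subset _ _)))]
    simp only [ray_iff]
  have h2 : (2 : ℤ) ∣ winding O x - (O.filter fun d => raySign x d ≠ 0).card := by
    rw [Finset.card_filter, Nat.cast_sum, winding, ← Finset.sum_sub_distrib]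
    refine Finset.dvd_sum fun d _ => ?_
    obtain ⟨⟨a, b⟩, i⟩ := d
    cases i <;> simp only [raySign] <;> split_ifs <;> simp_all
  simp only [inside, Set.mem_ofPred_eq]
  rw [h1, ← Int.odd_coe_nat, Int.odd_iff, Int.odd_iff]
  omega

theorem dualEdge_mem_dartEdges {O : Finset ((ℤ × ℤ) × Dir)} {e : (ℤ × ℤ) × Bool} :
    dualEdge e ∈ dartEdges O ↔ fwd e ∈ O ∨ bwd e ∈ O := by
  simp only [dartEdges, Finset.mem_image, dartEdge_eq_dualEdge_iff]
  constructor
  · rintro ⟨d, hd, rfl | rfl⟩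
    exacts [Or.inl hd, Or.inr hd]
  · rintro (h | h)
    exacts [⟨_, h, Or.inl rfl⟩, ⟨_, h, Or.inr rfl⟩]

section orbit

variable (d : bdDarts S)

theorem not_fwd_and_bwd {O : Finset ((ℤ × ℤ) × Dir)} (hO : O ⊆ bdDarts S)
    (e : (ℤ × ℤ) × Bool) : ¬ (fwd e ∈ O ∧ bwd e ∈ O) := by
  rintro ⟨h1, h2⟩
  have h := (mem_bdDarts.1 (hO h1)).2
  rw [right_fwd] at h
  exact h (mem_bdDarts.1 (hO h2)).1

/-- A boundary curve separates two neighbours exactly if it crosses the edge between them. -/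
theorem dualEdge_mem_orbit_iff (e : (ℤ × ℤ) × Bool) : dualEdge e ∈ dartEdges (orbit d) ↔
    ¬ (e.1 ∈ inside (dartEdges (orbit d)) ↔ tgt e ∈ inside (dartEdges (orbit d))) := by
  rw [mem_inside_iff_odd_winding (orbit_subset d), mem_inside_iff_odd_winding (orbit_subset d),
    dualEdge_mem_dartEdges]
  have h := winding_sub (orbit_subset d) (fun _ => next_mem_orbit d) e
  have h' := not_fwd_and_bwd (orbit_subset d) e
  rw [Int.odd_iff, Int.odd_iff]
  by_cases h1 : fwd e ∈ orbit d <;> by_cases h2 : bwd e ∈ orbit d <;>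
    simp only [h1, h2, if_true, if_false] at h h' ⊢ <;> simp at h' ⊢ <;> omega

theorem exists_edge_of_dart (x : (ℤ × ℤ) × Dir) : ∃ e : (ℤ × ℤ) × Bool, x = fwd e ∨ x = bwd e := by
  obtain ⟨⟨a, b⟩, i⟩ := x
  cases i
  · exact ⟨((a, b), false), by simp [fwd]⟩
  · exact ⟨((a, b), true), by simp [fwd]⟩
  · exact ⟨((a - 1, b), false), by simp [bwd, tgt, unitVec]⟩
  · exact ⟨((a, b - 1), true), by simp [bwd, tgt, unitVec]⟩

/-- Two neighbours are separated by a boundary curve if the dart from one to the other belongs to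
it. -/
theorem inside_ne_of_mem_orbit {x : (ℤ × ℤ) × Dir} (hx : x ∈ orbit d) :
    ¬ (x.1 ∈ inside (dartEdges (orbit d)) ↔ right x ∈ inside (dartEdges (orbit d))) := by
  obtain ⟨e, rfl | rfl⟩ := exists_edge_of_dart x
  · rw [right_fwd]
    exact (dualEdge_mem_orbit_iff d e).1 (dualEdge_mem_dartEdges.2 (Or.inl hx))
  · rw [right_bwd]
    have := (dualEdge_mem_orbit_iff d e).1 (dualEdge_mem_dartEdges.2 (Or.inr hx))
    change ¬ (tgt e ∈ _ ↔ _)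
    tauto

/-- Neighbours which both belong to `S` are not separated by a boundary curve of `S`. -/
theorem inside_iff_of_mem {x : (ℤ × ℤ) × Dir} (h1 : x.1 ∈ S) (h2 : right x ∈ S) :
    x.1 ∈ inside (dartEdges (orbit d)) ↔ right x ∈ inside (dartEdges (orbit d)) := by
  obtain ⟨e, rfl | rfl⟩ := exists_edge_of_dart x
  all_goals
    simp only [right_fwd, right_bwd] at h2 ⊢
    have h3 : dualEdge e ∉ dartEdges (orbit d) := by
      rw [dualEdge_mem_dartEdges]
      rintro (h | h)
      · have := (mem_bdDarts.1 (orbit_subset d h)).2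
        rw [right_fwd] at this
        first | exact this h2 | exact this h1
      · have := (mem_bdDarts.1 (orbit_subset d h)).2
        rw [right_bwd] at this
        first | exact this h2 | exact this h1
    rw [dualEdge_mem_orbit_iff, not_not] at h3
  · exact h3
  · exact h3.symm

/-- The side of a boundary curve on which its interior lies does not change along the curve. -/
theorem inside_next_iff {x : (ℤ × ℤ) × Dir} (hx : x ∈ orbit d) :
    (next S x).1 ∈ inside (dartEdges (orbit d)) ↔ x.1 ∈ inside (dartEdges (orbit d)) := by
  have hx' := next_mem_orbit d hx
  have h1 := inside_ne_of_mem_orbit d hx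
  have h2 := inside_ne_of_mem_orbit d hx'
  -- A left turn keeps the vertex of `S`, a right turn keeps the outer vertex, and going straight
  -- leads to a neighbour in `S`, which the curve does not separate from the old vertex.
  have h3 : (next S x).1 = x.1 ∨ right (next S x) = right x ∨
      ((next S x).1 ∈ S ∧ ∃ i, right (x.1, i) = (next S x).1) := by
    obtain ⟨⟨a, b⟩, i⟩ := x
    cases i <;> simp only [next] <;> split_ifs
    all_goals first
      | exact Or.inl rfl
      | (refine Or.inr (Or.inl ?_); simp [right]; done)
      | refine Or.inr (Or.inr ⟨by simp_all, ?_⟩)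
        first
        | exact ⟨.north, rfl⟩
        | exact ⟨.west, rfl⟩
        | exact ⟨.south, rfl⟩
        | exact ⟨.east, rfl⟩
  rcases h3 with h3 | h3 | ⟨h3, i, hi⟩
  · rw [h3]
  · rw [h3] at h2
    tauto
  · rw [← hi] at h3 ⊢
    exact (inside_iff_of_mem d (x := (x.1, i)) (mem_bdDarts.1 (orbit_subset d hx)).1 h3).symm

end orbit

end

section

variable {S : Finset (ℤ × ℤ)}

theorem inside_iff_of_orbit (d : bdDarts S) {x : (ℤ × ℤ) × Dir} (hx : x ∈ orbit d) :
    x.1 ∈ inside (dartEdges (orbit d)) ↔ (d : (ℤ × ℤ) × Dir).1 ∈ inside (dartEdges (orbit d)) :=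
  orbit_induction d (P := fun x => x.1 ∈ inside (dartEdges (orbit d)) ↔
    (d : (ℤ × ℤ) × Dir).1 ∈ inside (dartEdges (orbit d))) Iff.rfl
    (fun _ hx h => (inside_next_iff d hx).trans h) hx

open Classical in
/-- The winding number of a boundary curve is, up to a sign, the indicator of its interior. -/
theorem winding_orbit (d : bdDarts S) : winding (orbit d) = fun x =>
    (if (d : (ℤ × ℤ) × Dir).1 ∈ inside (dartEdges (orbit d)) then 1 else -1) *
      if x ∈ inside (dartEdges (orbit d)) then 1 else 0 := by
  obtain ⟨N, hN⟩ := exists_winding_eq_zero (orbit d)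
  refine eq_of_horizontal_sub_eq (N := N) (fun u => ?_) fun x hx => ?_
  · rw [winding_sub_false]
    have h0 := dualEdge_mem_orbit_iff d (u, false)
    have h1 := not_fwd_and_bwd (orbit_subset d) (u, false)
    rw [dualEdge_mem_dartEdges] at h0
    by_cases hf : fwd (u, false) ∈ orbit d
    · have h2 := inside_iff_of_orbit d hf
      change u ∈ _ ↔ _ at h2
      rw [← h2]
      simp only [hf, true_or, true_iff, true_and] at h0 h1
      by_cases hu : u ∈ inside (dartEdges (orbit d)) <;>
        by_cases hv : tgt (u, false) ∈ inside (dartEdges (orbit d)) <;> simp_all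
    · by_cases hb : bwd (u, false) ∈ orbit d
      · have h2 := inside_iff_of_orbit d hb
        change tgt (u, false) ∈ _ ↔ _ at h2
        rw [← h2]
        simp only [hb, or_true, true_iff] at h0
        by_cases hu : u ∈ inside (dartEdges (orbit d)) <;>
          by_cases hv : tgt (u, false) ∈ inside (dartEdges (orbit d)) <;> simp_all
      · simp only [hf, hb, or_self, false_iff, not_not] at h0
        change u ∈ _ ↔ _ at h0
        simp [hf, hb, h0]
  · rw [if_neg (show x ∉ _ by
      rw [mem_inside_iff_odd_winding (orbit_subset d), hN x hx]
      decide)]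
    simp [hN x hx]

/-- A vertex of `S` is enclosed by a boundary curve whose interior lies on the side of `S`. -/
theorem exists_orbit_inside {x : ℤ × ℤ} (hx : x ∈ S) : ∃ d : bdDarts S,
    (d : (ℤ × ℤ) × Dir).1 ∈ inside (dartEdges (orbit d)) ∧ x ∈ inside (dartEdges (orbit d)) := by
  classical
  -- The windings of all boundary curves add up to the indicator of `S`. Curves with interior on the
  -- other side contribute at most 0, so some curve of the right kind encloses x.
  have h1 : ∑ O ∈ Finset.univ.image (orbit (S := S)), winding O x = 1 := by
    have h := congrFun (winding_bdDarts S) x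
    simp only [hx, if_true] at h
    rw [← h]
    change _ = ∑ d ∈ bdDarts S, raySign x d
    rw [← Finset.sum_coe_sort (bdDarts S), ← Finset.sum_fiberwise_of_maps_to
      (g := orbit (S := S)) (t := Finset.univ.image (orbit (S := S)))
      fun d _ => Finset.mem_image_of_mem _ (Finset.mem_univ d)]
    refine Finset.sum_congr rfl fun O hO => ?_
    obtain ⟨d, _, rfl⟩ := Finset.mem_image.1 hO
    rw [winding]
    conv_lhs => rw [orbit]
    rw [Finset.sum_map]
    refine Finset.sum_congr (Finset.filter_congr fun d' _ => ?_) fun _ _ => rfl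
    rw [eq_comm, orbit_eq_iff]
  by_contra! hcon
  have h2 : ∑ O ∈ Finset.univ.image (orbit (S := S)), winding O x ≤ 0 := by
    refine Finset.sum_nonpos fun O hO => ?_
    obtain ⟨d, _, rfl⟩ := Finset.mem_image.1 hO
    have h := congrFun (winding_orbit d) x
    rw [h]
    have := hcon d
    split_ifs <;> simp_all
  omega

/-! ### Level curves of a finite set -/

/-- `γ` is a geometric contour which separates two neighbours if and only if it crosses the edge
between them. -/
structure IsSeparating (γ : Finset (Sym2 (ℤ × ℤ))) : Prop where
  isGeometricContour : IsGeometricContour γ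
  mem_iff : ∀ e, dualEdge e ∈ γ ↔ ¬ (e.1 ∈ inside γ ↔ tgt e ∈ inside γ)

/-- `S` contains the vertices along `γ` in its interior, and none of those in its exterior. -/
def IsLevelCurve (S : Finset (ℤ × ℤ)) (γ : Finset (Sym2 (ℤ × ℤ))) : Prop :=
  ∀ e, dualEdge e ∈ γ → (e.1 ∈ S ↔ e.1 ∈ inside γ) ∧ (tgt e ∈ S ↔ tgt e ∈ inside γ)

/-- The curves kept are the orbits whose darts start in their own interior; those bounding holes of
`S` are dropped. Distinct orbits share no dual edge. -/
theorem exists_levelCurves (S : Finset (ℤ × ℤ)) : ∃ P : Finset (Finset (Sym2 (ℤ × ℤ))),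
    (∀ γ ∈ P, IsSeparating γ ∧ IsLevelCurve S γ) ∧
    (∀ γ ∈ P, ∀ γ' ∈ P, ∀ e, dualEdge e ∈ γ → dualEdge e ∈ γ' → γ = γ') ∧
    ∀ x ∈ S, ∃ γ ∈ P, x ∈ inside γ := by
  classical
  refine ⟨(Finset.univ.filter fun d : bdDarts S =>
    (d : (ℤ × ℤ) × Dir).1 ∈ inside (dartEdges (orbit d))).image fun d => dartEdges (orbit d),
    ?_, ?_, ?_⟩
  · intro γ hγ
    obtain ⟨d, hd, rfl⟩ := Finset.mem_image.1 hγ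
    have hpos := (Finset.mem_filter.1 hd).2
    refine ⟨⟨isGeometricContour_orbit d, dualEdge_mem_orbit_iff d⟩, fun e he => ?_⟩
    have hsep := (dualEdge_mem_orbit_iff d e).1 he
    rcases dualEdge_mem_dartEdges.1 he with h | h
    · have h1 : e.1 ∈ inside _ := (inside_iff_of_orbit d h).2 hpos
      have h2 := mem_bdDarts.1 (orbit_subset d h)
      have h3 : e.1 ∈ S := h2.1
      have h4 := h2.2
      rw [right_fwd] at h4
      tauto
    · have h1 : tgt e ∈ inside _ := (inside_iff_of_orbit d h).2 hpos
      have h2 := mem_bdDarts.1 (orbit_subset d h)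
      have h3 : tgt e ∈ S := h2.1
      have h4 := h2.2
      rw [right_bwd] at h4
      tauto
  · intro γ hγ γ' hγ' e he he'
    obtain ⟨d, -, rfl⟩ := Finset.mem_image.1 hγ
    obtain ⟨d', -, rfl⟩ := Finset.mem_image.1 hγ'
    have key : ∀ x, x ∈ orbit d → x ∈ orbit d' → dartEdges (orbit d) = dartEdges (orbit d') := by
      intro x hx hx'
      lift x to bdDarts S using orbit_subset d hx
      rw [coe_mem_orbit] at hx hx'
      rw [orbit_eq_iff.2 (hx.trans hx'.symm)]
    rw [dualEdge_mem_dartEdges] at he he'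
    rcases he with h | h <;> rcases he' with h' | h'
    · exact key _ h h'
    · exact absurd (And.intro (orbit_subset _ h) (orbit_subset _ h'))
        (not_fwd_and_bwd subset_rfl e)
    · exact absurd (And.intro (orbit_subset _ h') (orbit_subset _ h))
        (not_fwd_and_bwd subset_rfl e)
    · exact key _ h h'
  · intro x hx
    obtain ⟨d, hd, hxd⟩ := exists_orbit_inside hx
    exact ⟨_, Finset.mem_image_of_mem _ (Finset.mem_filter.2 ⟨Finset.mem_univ d, hd⟩), hxd⟩

end

section

/-! ### The perimeter of a contour -/

theorem dualEdge_injective : Function.Injective dualEdge := by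
  rintro ⟨⟨a, b⟩, i⟩ ⟨⟨a', b'⟩, j⟩ h
  cases i <;> cases j <;> simp [dualEdge, crossingEdge] at h ⊢ <;> omega

theorem IsDualEdge.exists_eq_dualEdge {f : Sym2 (ℤ × ℤ)} (hf : IsDualEdge f) :
    ∃ e, f = dualEdge e := by
  obtain ⟨⟨a, b⟩, ⟨c, d⟩, hpq, rfl⟩ := hf
  have h : (c = a + 1 ∧ d = b) ∨ (c = a - 1 ∧ d = b) ∨ (c = a ∧ d = b + 1) ∨
      (c = a ∧ d = b - 1) := by
    simp only [Adj] at hpq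
    rcases abs_cases (a - c) with h | h <;> rcases abs_cases (b - d) with h' | h' <;> omega
  rcases h with ⟨rfl, rfl⟩ | ⟨rfl, rfl⟩ | ⟨rfl, rfl⟩ | ⟨rfl, rfl⟩
  · exact ⟨((a + 1, d), true), by simp [dualEdge]⟩
  · exact ⟨((a, d), true), by simp [dualEdge]⟩
  · exact ⟨((c, b + 1), false), by simp [dualEdge, crossingEdge]⟩
  · exact ⟨((c, b), false), by simp [dualEdge, crossingEdge]⟩

variable {γ γ' : Finset (Sym2 (ℤ × ℤ))}

theorem IsSeparating.exists_eq_dualEdge (hγ : IsSeparating γ) {f : Sym2 (ℤ × ℤ)} (hf : f ∈ γ) :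
    ∃ e, f = dualEdge e := by
  obtain ⟨n, s, hs, h⟩ := hγ.isGeometricContour
  have : f ∈ Set.range s := h ▸ Finset.mem_coe.2 hf
  obtain ⟨i, rfl⟩ := this
  exact (hs.dualEdge i).exists_eq_dualEdge

theorem IsSeparating.eq_of_inside_eq (hγ : IsSeparating γ) (hγ' : IsSeparating γ')
    (h : inside γ = inside γ') : γ = γ' := by
  have key : ∀ e, dualEdge e ∈ γ ↔ dualEdge e ∈ γ' := by
    intro e
    rw [hγ.mem_iff, hγ'.mem_iff, h]
  ext f
  constructor
  · intro hf
    obtain ⟨e, rfl⟩ := hγ.exists_eq_dualEdge hf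
    exact (key e).1 hf
  · intro hf
    obtain ⟨e, rfl⟩ := hγ'.exists_eq_dualEdge hf
    exact (key e).2 hf

theorem exists_edges (γ : Finset (Sym2 (ℤ × ℤ))) :
    ∃ E : Finset ((ℤ × ℤ) × Bool), (∀ e, e ∈ E ↔ dualEdge e ∈ γ) ∧ E.card ≤ γ.card := by
  classical
  refine ⟨γ.preimage dualEdge dualEdge_injective.injOn, by simp, ?_⟩
  exact Finset.card_le_card_of_injOn dualEdge (fun e he => by simpa using he)
    dualEdge_injective.injOn

theorem exists_crossing_of_mem_inside {x : ℤ × ℤ} (hx : x ∈ inside γ) :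
    ∃ k : ℕ, dualEdge ((x.1 + k, x.2), false) ∈ γ := by
  classical
  simp only [inside, Set.mem_ofPred_eq] at hx
  obtain ⟨e, he⟩ := Finset.card_pos.1 hx.pos
  obtain ⟨h, k, rfl⟩ := Finset.mem_filter.1 he
  exact ⟨k, h⟩

theorem IsSeparating.finite_inside (hγ : IsSeparating γ) : (inside γ).Finite := by
  classical
  obtain ⟨E, hE, -⟩ := exists_edges γ
  obtain ⟨N, hN⟩ : ∃ N : ℤ, ∀ e ∈ E, |e.1.1| ≤ N ∧ |e.1.2| ≤ N := by
    obtain ⟨N, hN⟩ := (E.image fun e => max |e.1.1| |e.1.2|).bddAbove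
    refine ⟨N, fun e he => ?_⟩
    have : max |e.1.1| |e.1.2| ≤ N := hN (Finset.mem_coe.2 (Finset.mem_image_of_mem _ he))
    exact ⟨(le_max_left _ _).trans this, (le_max_right _ _).trans this⟩
  have h1 : ∀ x ∈ inside γ, x.1 ≤ N ∧ -N ≤ x.2 ∧ x.2 ≤ N := by
    intro x hx
    obtain ⟨k, hk⟩ := exists_crossing_of_mem_inside hx
    have := hN _ ((hE _).2 hk)
    simp only [abs_le] at this
    omega
  -- The half-line to the right says nothing about vertices far to the left. From such a vertex one
  -- climbs n steps without crossing `γ`, to a height above all of `γ`.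
  have h2 : ∀ n : ℕ, ∀ x : ℤ × ℤ, x.1 < -N → N < x.2 + n → x ∉ inside γ := by
    intro n
    induction n with
    | zero =>
      intro x _ h hx
      have := h1 x hx
      push_cast at h
      omega
    | succ n ih =>
      intro x hx h
      have h3 : dualEdge (x, true) ∉ γ := by
        rw [← hE]
        intro h3
        have := (hN _ h3).1
        simp only [abs_le] at this
        omega
      rw [hγ.mem_iff, not_not] at h3
      change x ∈ _ ↔ _ at h3
      rw [h3]
      refine ih _ ?_ ?_
      · simpa [tgt, unitVec] using hx
      · simp only [tgt, unitVec, Prod.snd_add]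
        push_cast at h
        omega
  refine (Set.finite_Icc (-N, -N) (N, N)).subset fun x hx => ?_
  have h3 := h1 x hx
  have h4 : -N ≤ x.1 := by
    by_contra h
    exact h2 (N + 1 - x.2).toNat x (by omega) (by omega) hx
  exact ⟨Prod.mk_le_mk.2 ⟨h4, h3.2.1⟩, Prod.mk_le_mk.2 ⟨h3.1, h3.2.2⟩⟩

theorem exists_last {P : ℤ → Prop} (hfin : {a | P a}.Finite) {a : ℤ} (ha : P a) :
    ∃ c, P c ∧ ¬ P (c + 1) := by
  by_contra! h
  have h' : ∀ n : ℕ, P (a + n) := by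
    intro n
    induction n with
    | zero => simpa using ha
    | succ n ih =>
      have := h _ ih
      push_cast
      rwa [← add_assoc]
  exact Set.infinite_of_injective_forall_mem (fun m n hmn => by simpa using hmn) h' hfin

theorem exists_first {P : ℤ → Prop} (hfin : {a | P a}.Finite) {a : ℤ} (ha : P a) :
    ∃ c, ¬ P c ∧ P (c + 1) := by
  obtain ⟨c, hc, hc'⟩ := exists_last (P := fun b => P (-b)) (a := -a)
    (hfin.preimage neg_injective.injOn) (by simpa using ha)
  exact ⟨-(c + 1), hc', by simpa using hc⟩

/-- A contour is at least as long as the boundary of the smallest box around its interior; if it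
is not longer than that of a box with prescribed sides, its interior is contained in that box. -/
theorem IsSeparating.le_card (hγ : IsSeparating γ) (C R : Finset ℤ)
    (hC : ∀ c ∈ C, ∃ r, (c, r) ∈ inside γ) (hR : ∀ r ∈ R, ∃ c, (c, r) ∈ inside γ) :
    2 * (C.card + R.card) ≤ γ.card ∧
      (γ.card ≤ 2 * (C.card + R.card) → ∀ z ∈ inside γ, z.1 ∈ C ∧ z.2 ∈ R) := by
  classical
  obtain ⟨E, hE, hcard⟩ := exists_edges γ
  obtain ⟨I, hI⟩ : ∃ I : Finset (ℤ × ℤ), ∀ x, x ∈ I ↔ x ∈ inside γ :=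
    ⟨hγ.finite_inside.toFinset, by simp⟩
  have hE' : ∀ e, e ∈ E ↔ ¬ (e.1 ∈ I ↔ tgt e ∈ I) := by
    intro e
    rw [hE, hγ.mem_iff, hI, hI]
  have hrow : ∀ r ∈ I.image Prod.snd, (∃ c, (c, r) ∈ I ∧ (c + 1, r) ∉ I) ∧
      ∃ c, (c, r) ∉ I ∧ (c + 1, r) ∈ I := by
    intro r hr
    obtain ⟨⟨c, r⟩, hc, rfl⟩ := Finset.mem_image.1 hr
    have hfin : {a | (a, r) ∈ I}.Finite :=
      I.finite_toSet.preimage (f := fun a => (a, r)) fun a _ b _ h => (Prod.mk.inj h).1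
    exact ⟨exists_last hfin hc, exists_first hfin hc⟩
  have hcol : ∀ c ∈ I.image Prod.fst, (∃ r, (c, r) ∈ I ∧ (c, r + 1) ∉ I) ∧
      ∃ r, (c, r) ∉ I ∧ (c, r + 1) ∈ I := by
    intro c hc
    obtain ⟨⟨c, r⟩, hr, rfl⟩ := Finset.mem_image.1 hc
    have hfin : {a | (c, a) ∈ I}.Finite :=
      I.finite_toSet.preimage (f := fun a => (c, a)) fun a _ b _ h => (Prod.mk.inj h).2
    exact ⟨exists_last hfin hr, exists_first hfin hr⟩
  -- Every row that meets the interior is entered and left once at least, and so is every column.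
  -- The next four bounds concern disjoint classes of edges, which gives the factor 2.
  have h1 : (I.image Prod.snd).card ≤ ((E.filter (·.2 = false)).filter (·.1 ∈ I)).card := by
    refine (Finset.card_le_card (t := Finset.image (fun e => e.1.2) _) fun r hr => ?_).trans
      Finset.card_image_le
    obtain ⟨c, h, h'⟩ := (hrow r hr).1
    refine Finset.mem_image.2 ⟨((c, r), false), ?_, rfl⟩
    simp [hE', tgt, unitVec, h, h']
  have h2 : (I.image Prod.snd).card ≤ ((E.filter (·.2 = false)).filter (¬ ·.1 ∈ I)).card := by
    refine (Finset.card_le_card (t := Finset.image (fun e => e.1.2) _) fun r hr => ?_).trans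
      Finset.card_image_le
    obtain ⟨c, h, h'⟩ := (hrow r hr).2
    refine Finset.mem_image.2 ⟨((c, r), false), ?_, rfl⟩
    simp [hE', tgt, unitVec, h, h']
  have h3 : (I.image Prod.fst).card ≤ ((E.filter (¬ ·.2 = false)).filter (·.1 ∈ I)).card := by
    refine (Finset.card_le_card (t := Finset.image (fun e => e.1.1) _) fun c hc => ?_).trans
      Finset.card_image_le
    obtain ⟨r, h, h'⟩ := (hcol c hc).1
    refine Finset.mem_image.2 ⟨((c, r), true), ?_, rfl⟩
    simp [hE', tgt, unitVec, h, h']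
  have h4 : (I.image Prod.fst).card ≤ ((E.filter (¬ ·.2 = false)).filter (¬ ·.1 ∈ I)).card := by
    refine (Finset.card_le_card (t := Finset.image (fun e => e.1.1) _) fun c hc => ?_).trans
      Finset.card_image_le
    obtain ⟨r, h, h'⟩ := (hcol c hc).2
    refine Finset.mem_image.2 ⟨((c, r), true), ?_, rfl⟩
    simp [hE', tgt, unitVec, h, h']
  have h5 := Finset.card_filter_add_card_filter_not (s := E) (·.2 = false)
  have h6 := Finset.card_filter_add_card_filter_not (s := E.filter (·.2 = false)) (·.1 ∈ I)
  have h7 := Finset.card_filter_add_card_filter_not (s := E.filter (¬ ·.2 = false)) (·.1 ∈ I)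
  have hC' : C ⊆ I.image Prod.fst := by
    intro c hc
    obtain ⟨r, hr⟩ := hC c hc
    exact Finset.mem_image.2 ⟨_, (hI _).2 hr, rfl⟩
  have hR' : R ⊆ I.image Prod.snd := by
    intro r hr
    obtain ⟨c, hc⟩ := hR r hr
    exact Finset.mem_image.2 ⟨_, (hI _).2 hc, rfl⟩
  have h8 := Finset.card_le_card hC'
  have h9 := Finset.card_le_card hR'
  refine ⟨by omega, fun h z hz => ?_⟩
  rw [Finset.eq_of_subset_of_card_le hC' (by omega), Finset.eq_of_subset_of_card_le hR' (by omega)]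
  exact ⟨Finset.mem_image_of_mem _ ((hI z).2 hz), Finset.mem_image_of_mem _ ((hI z).2 hz)⟩

theorem IsSeparating.card_of_mem (hγ : IsSeparating γ) {x : ℤ × ℤ} (hx : x ∈ inside γ) :
    4 ≤ γ.card ∧ (γ.card ≤ 4 → ∀ z ∈ inside γ, z = x) := by
  have h := hγ.le_card {x.1} {x.2} (by simpa using ⟨x.2, hx⟩) (by simpa using ⟨x.1, hx⟩)
  simp only [Finset.card_singleton, Finset.mem_singleton] at h
  exact ⟨h.1, fun h' z hz => Prod.ext (h.2 h' z hz).1 (h.2 h' z hz).2⟩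

theorem IsSeparating.card_of_mem_mem (hγ : IsSeparating γ) {x y : ℤ × ℤ} (hx : x ∈ inside γ)
    (hy : y ∈ inside γ) (hxy : Adj x y) :
    6 ≤ γ.card ∧ (γ.card ≤ 6 → ∀ z ∈ inside γ, z = x ∨ z = y) := by
  obtain ⟨a, b⟩ := x
  obtain ⟨c, d⟩ := y
  have h : (a ≠ c ∧ d = b) ∨ (c = a ∧ b ≠ d) := by
    simp only [Adj] at hxy
    rcases abs_cases (a - c) with h | h <;> rcases abs_cases (b - d) with h' | h' <;> omega
  rcases h with ⟨h, rfl⟩ | ⟨rfl, h⟩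
  · have := hγ.le_card {a, c} {d} (by simpa using ⟨⟨d, hx⟩, ⟨d, hy⟩⟩) (by simpa using ⟨a, hx⟩)
    simp only [Finset.card_pair h, Finset.card_singleton, Finset.mem_singleton,
      Finset.mem_insert] at this
    refine ⟨this.1, fun h' z hz => ?_⟩
    have := this.2 h' z hz
    rcases this with ⟨h1 | h1, h2⟩
    exacts [Or.inl (Prod.ext h1 h2), Or.inr (Prod.ext h1 h2)]
  · have := hγ.le_card {c} {b, d} (by simpa using ⟨b, hx⟩) (by simpa using ⟨⟨c, hx⟩, ⟨c, hy⟩⟩)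
    simp only [Finset.card_pair h, Finset.card_singleton, Finset.mem_singleton,
      Finset.mem_insert] at this
    refine ⟨this.1, fun h' z hz => ?_⟩
    have := this.2 h' z hz
    rcases this with ⟨h1, h2 | h2⟩
    exacts [Or.inl (Prod.ext h1 h2), Or.inr (Prod.ext h1 h2)]

theorem IsSeparating.card_of_mem_mem_mem (hγ : IsSeparating γ) {x y z : ℤ × ℤ}
    (hx : x ∈ inside γ) (hy : y ∈ inside γ) (hz : z ∈ inside γ) (hxy : Adj x y) (hyz : Adj y z)
    (hxz : x ≠ z) :
    8 ≤ γ.card ∧ (γ.card ≤ 8 → ∀ w ∈ inside γ, w = x ∨ w = y ∨ w = z ∨ w = x + z - y) := by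
  obtain ⟨a, b⟩ := x
  obtain ⟨c, d⟩ := y
  obtain ⟨e, f⟩ := z
  have h : (a ≠ c ∧ d = b) ∨ (c = a ∧ b ≠ d) := by
    simp only [Adj] at hxy
    rcases abs_cases (a - c) with h | h <;> rcases abs_cases (b - d) with h' | h' <;> omega
  have h' : (c ≠ e ∧ f = d) ∨ (e = c ∧ d ≠ f) := by
    simp only [Adj] at hyz
    rcases abs_cases (c - e) with h | h <;> rcases abs_cases (d - f) with h' | h' <;> omega
  simp only [ne_eq, Prod.mk.injEq] at hxz
  rcases h with ⟨h, rfl⟩ | ⟨rfl, h⟩ <;> rcases h' with ⟨h', rfl⟩ | ⟨rfl, h'⟩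
  · have h'' : a ≠ e := by simpa using hxz
    have := hγ.le_card {a, c, e} {f} (by simpa using ⟨⟨f, hx⟩, ⟨f, hy⟩, ⟨f, hz⟩⟩)
      (by simpa using ⟨a, hx⟩)
    have hc : ({a, c, e} : Finset ℤ).card = 3 := Finset.card_eq_three.2 ⟨a, c, e, h, h'', h', rfl⟩
    simp only [hc, Finset.card_singleton, Finset.mem_singleton, Finset.mem_insert] at this
    refine ⟨this.1, fun h' w hw => ?_⟩
    have := this.2 h' w hw
    obtain ⟨w1, w2⟩ := w
    simp only [Prod.mk.injEq] at this ⊢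
    omega
  · have := hγ.le_card {a, e} {d, f} (by simpa using ⟨⟨d, hx⟩, ⟨f, hz⟩⟩)
      (by simpa using ⟨⟨a, hx⟩, ⟨e, hz⟩⟩)
    simp only [Finset.card_pair h, Finset.card_pair h', Finset.mem_singleton,
      Finset.mem_insert] at this
    refine ⟨this.1, fun h' w hw => ?_⟩
    have := this.2 h' w hw
    obtain ⟨w1, w2⟩ := w
    simp only [Prod.mk.injEq, Prod.mk_add_mk, Prod.mk_sub_mk] at this ⊢
    omega
  · have := hγ.le_card {c, e} {b, f} (by simpa using ⟨⟨b, hx⟩, ⟨f, hz⟩⟩)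
      (by simpa using ⟨⟨c, hx⟩, ⟨e, hz⟩⟩)
    simp only [Finset.card_pair h, Finset.card_pair h', Finset.mem_singleton,
      Finset.mem_insert] at this
    refine ⟨this.1, fun h' w hw => ?_⟩
    have := this.2 h' w hw
    obtain ⟨w1, w2⟩ := w
    simp only [Prod.mk.injEq, Prod.mk_add_mk, Prod.mk_sub_mk] at this ⊢
    omega
  · have h'' : b ≠ f := by simpa using hxz
    have := hγ.le_card {e} {b, d, f} (by simpa using ⟨b, hx⟩)
      (by simpa using ⟨⟨e, hx⟩, ⟨e, hy⟩, ⟨e, hz⟩⟩)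
    have hc : ({b, d, f} : Finset ℤ).card = 3 := Finset.card_eq_three.2 ⟨b, d, f, h, h'', h', rfl⟩
    simp only [hc, Finset.card_singleton, Finset.mem_singleton, Finset.mem_insert] at this
    refine ⟨this.1, fun h' w hw => ?_⟩
    have := this.2 h' w hw
    obtain ⟨w1, w2⟩ := w
    simp only [Prod.mk.injEq] at this ⊢
    omega

end

section

variable {Λ : Finset (ℤ × ℤ)}

/-! ### Removal of level contours -/

open Classical in
-- The energy identity on one edge, with end heights u and v. A contour that crosses the edge lowers
-- exactly the higher end; the others lower both ends or neither. At most one contour per level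
-- crosses, and only at levels between v and u, so the difference never changes sign.
theorem abs_sub_eq_of_levels {α : Type*} (n : ℕ) (u v : ℤ) (Γ : ℕ → Finset α)
    (D U V : α → Prop) [DecidablePred D]
    (h1 : ∀ k < n, ∀ γ ∈ Γ k, D γ → ((k : ℤ) + 1 ≤ u ↔ U γ) ∧ ((k : ℤ) + 1 ≤ v ↔ V γ))
    (h2 : ∀ k < n, ∀ γ ∈ Γ k, D γ ↔ ¬ (U γ ↔ V γ))
    (h3 : ∀ k < n, ∀ γ ∈ Γ k, ∀ γ' ∈ Γ k, D γ → D γ' → γ = γ') :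
    |u - v| = |(u - ∑ k ∈ Finset.range n, ∑ γ ∈ Γ k, if U γ then 1 else 0) -
      (v - ∑ k ∈ Finset.range n, ∑ γ ∈ Γ k, if V γ then 1 else 0)| +
      ∑ k ∈ Finset.range n, ∑ γ ∈ Γ k, if D γ then 1 else 0 := by
  wlog huv : v ≤ u generalizing u v U V
  · rw [abs_sub_comm, this v u V U (fun k hk γ hγ hD => (h1 k hk γ hγ hD).symm)
      (fun k hk γ hγ => (h2 k hk γ hγ).trans (by tauto)) (by omega), abs_sub_comm]
  set N : ℤ := ∑ k ∈ Finset.range n, ∑ γ ∈ Γ k, if D γ then 1 else 0 with hN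
  have hsub : ∑ k ∈ Finset.range n, ∑ γ ∈ Γ k, (if U γ then 1 else 0 : ℤ) -
      ∑ k ∈ Finset.range n, ∑ γ ∈ Γ k, (if V γ then 1 else 0 : ℤ) = N := by
    rw [hN, ← Finset.sum_sub_distrib]
    refine Finset.sum_congr rfl fun k hk => ?_
    rw [← Finset.sum_sub_distrib]
    refine Finset.sum_congr rfl fun γ hγ => ?_
    have hk' := Finset.mem_range.1 hk
    have h1 := h1 k hk' γ hγ
    have h2 := h2 k hk' γ hγ
    by_cases hD : D γ
    · have := h1 hD
      by_cases hU : U γ <;> by_cases hV : V γ <;> simp_all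
      omega
    · by_cases hU : U γ <;> by_cases hV : V γ <;> simp_all
  have hN0 : 0 ≤ N := Finset.sum_nonneg fun k _ => Finset.sum_nonneg fun γ _ => by
    split_ifs <;> simp
  have hNle : N ≤ u - v := by
    have hle : N ≤ ∑ k ∈ Finset.range n, if v < (k : ℤ) + 1 ∧ (k : ℤ) + 1 ≤ u then 1 else 0 := by
      refine Finset.sum_le_sum fun k hk => ?_
      have hk' := Finset.mem_range.1 hk
      rw [← Finset.sum_filter, Finset.sum_const, nsmul_eq_mul, mul_one]
      by_cases hne : ((Γ k).filter D).Nonempty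
      · obtain ⟨γ, hγ⟩ := hne
        obtain ⟨hγ, hD⟩ := Finset.mem_filter.1 hγ
        have hcard : ((Γ k).filter D).card ≤ 1 := Finset.card_le_one.2 fun γ₁ hγ₁ γ₂ hγ₂ =>
          h3 k hk' _ (Finset.mem_filter.1 hγ₁).1 _ (Finset.mem_filter.1 hγ₂).1
            (Finset.mem_filter.1 hγ₁).2 (Finset.mem_filter.1 hγ₂).2
        have h1 := h1 k hk' γ hγ hD
        have h2 := (h2 k hk' γ hγ).1 hD
        rw [if_pos]
        · exact_mod_cast hcard
        · rw [← h1.1, ← h1.2] at h2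
          omega
      · rw [Finset.not_nonempty_iff_eq_empty.1 hne]
        split_ifs <;> simp
    refine hle.trans ?_
    rw [← Finset.sum_filter, Finset.sum_const, nsmul_eq_mul, mul_one]
    have : ((Finset.range n).filter fun k : ℕ => v < (k : ℤ) + 1 ∧ (k : ℤ) + 1 ≤ u).card ≤
        (Finset.Ioc v u).card :=
      Finset.card_le_card_of_injOn (fun k : ℕ => (k : ℤ) + 1)
        (fun k hk => by simpa using (Finset.mem_filter.1 hk).2) fun a _ b _ h => by simpa using h
    rw [Int.card_Ioc] at this
    omega
  rw [abs_of_nonneg (by omega), abs_of_nonneg (by omega)]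
  omega

/-! ### Families of contours around a set, and the union bound over their multisets -/

/-- The total length of a family of contours. -/
def totalLength (Γ : Finset (Finset (Sym2 (ℤ × ℤ)))) : ℕ := ∑ γ ∈ Γ, γ.card

open Classical in
/-- The number of contours of a family which enclose `x`. -/
noncomputable def depth (Γ : Finset (Finset (Sym2 (ℤ × ℤ)))) (x : ℤ × ℤ) : ℤ :=
  ∑ γ ∈ Γ, if x ∈ inside γ then 1 else 0

theorem depth_nonneg (Γ : Finset (Finset (Sym2 (ℤ × ℤ)))) (x : ℤ × ℤ) : 0 ≤ depth Γ x :=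
  Finset.sum_nonneg fun γ _ => by split_ifs <;> simp

theorem depth_le_card (Γ : Finset (Finset (Sym2 (ℤ × ℤ)))) (x : ℤ × ℤ) :
    depth Γ x ≤ Γ.card := by
  rw [depth, ← nsmul_one Γ.card]
  exact Finset.sum_le_card_nsmul _ _ _ fun γ _ => by split_ifs <;> simp

open Classical in
/-- The contours along edges that touch `Λ` and which enclose a point of `A`. -/
noncomputable def enclosing (Λ A : Finset (ℤ × ℤ)) : Finset (Finset (Sym2 (ℤ × ℤ))) :=
  ((touching Λ).image dualEdge).powerset.filter fun γ =>
    IsSeparating γ ∧ ∃ a ∈ A, a ∈ inside γ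

open Classical in
/-- The families of contours around points of `A` that together enclose all of `A`. -/
noncomputable def coverings (Λ A : Finset (ℤ × ℤ)) :
    Finset (Finset (Finset (Sym2 (ℤ × ℤ)))) :=
  (enclosing Λ A).powerset.filter fun Γ => ∀ a ∈ A, ∃ γ ∈ Γ, a ∈ inside γ

theorem sum_fiber_card_mul {α : Type*} [DecidableEq α] {T : Finset α} {n : ℕ} {Γ : ℕ → α}
    (h : ∀ k < n, Γ k ∈ T) (F : α → ℤ) :
    ∑ G ∈ T, (((Finset.range n).filter fun k => Γ k = G).card : ℤ) * F G =
      ∑ k ∈ Finset.range n, F (Γ k) := by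
  rw [← Finset.sum_fiberwise_of_maps_to (g := Γ) (t := T) fun k hk => h k (Finset.mem_range.1 hk)]
  refine Finset.sum_congr rfl fun G _ => ?_
  rw [Finset.sum_congr rfl fun k hk => by rw [(Finset.mem_filter.1 hk).2], Finset.sum_const,
    nsmul_eq_mul]

theorem sum_touching_mem {γ : Finset (Sym2 (ℤ × ℤ))}
    (hγ : γ ⊆ (touching Λ).image dualEdge) :
    ∑ e ∈ touching Λ, (if dualEdge e ∈ γ then 1 else 0 : ℤ) = γ.card := by
  rw [← Finset.sum_filter, Finset.sum_const, nsmul_eq_mul, mul_one,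
    ← Finset.card_image_of_injective _ dualEdge_injective]
  congr 2
  ext f
  simp only [Finset.mem_image, Finset.mem_filter]
  constructor
  · rintro ⟨e, ⟨-, h⟩, rfl⟩
    exact h
  · intro hf
    obtain ⟨e, he, rfl⟩ := Finset.mem_image.1 (hγ hf)
    exact ⟨e, ⟨he, hf⟩, rfl⟩

/-- If all the heights on `A` are at least `n`, then `n` families of contours around `A` can be
removed from `φ`, and the energy decreases by their total length. -/
theorem exists_energy_eq (n : ℕ) (A : Finset (ℤ × ℤ)) (φ : Λ → ℤ)
    (hφ : ∀ a ∈ A, (n : ℤ) ≤ extend φ 0 a) :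
    ∃ M ∈ Finset.piAntidiag (coverings Λ A) n,
      energy Λ (extend φ 0) =
        energy Λ (fun x => extend φ 0 x - ∑ Γ ∈ coverings Λ A, (M Γ : ℤ) * depth Γ x) +
        ∑ Γ ∈ coverings Λ A, (M Γ : ℤ) * totalLength Γ := by
  classical
  -- The index k < n stands for the level k + 1 ≥ 1, which the zero heights outside Λ never reach.
  let lev : ℕ → Finset (ℤ × ℤ) := fun k => Λ.filter fun x => (k : ℤ) + 1 ≤ extend φ 0 x
  have hlev : ∀ k x, x ∈ lev k ↔ (k : ℤ) + 1 ≤ extend φ 0 x := by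
    intro k x
    simp only [lev, Finset.mem_filter, and_iff_right_iff_imp]
    intro h
    by_contra hx
    rw [extend_of_notMem _ _ hx] at h
    simp only [Pi.zero_apply] at h
    omega
  choose P hP1 hP2 hP3 using fun k => exists_levelCurves (lev k)
  let Γ : ℕ → Finset (Finset (Sym2 (ℤ × ℤ))) := fun k =>
    (P k).filter fun γ => ∃ a ∈ A, a ∈ inside γ
  have hsub : ∀ k, ∀ γ ∈ Γ k, γ ⊆ (touching Λ).image dualEdge := by
    intro k γ hγ f hf
    obtain ⟨hs, hl⟩ := hP1 k γ (Finset.mem_filter.1 hγ).1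
    obtain ⟨e, rfl⟩ := hs.exists_eq_dualEdge hf
    refine Finset.mem_image_of_mem _ (mem_touching.2 ?_)
    have h1 := (hs.mem_iff e).1 hf
    rw [← (hl e hf).1, ← (hl e hf).2] at h1
    by_contra! h2
    exact h1 ⟨fun h => absurd (Finset.mem_filter.1 h).1 h2.1,
      fun h => absurd (Finset.mem_filter.1 h).1 h2.2⟩
  have hΓ : ∀ k < n, Γ k ∈ coverings Λ A := by
    intro k hk
    refine Finset.mem_filter.2 ⟨Finset.mem_powerset.2 fun γ hγ => ?_, fun a ha => ?_⟩
    · exact Finset.mem_filter.2 ⟨Finset.mem_powerset.2 (hsub k γ hγ),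
        (hP1 k γ (Finset.mem_filter.1 hγ).1).1, (Finset.mem_filter.1 hγ).2⟩
    · have : a ∈ lev k := (hlev k a).2 (by have := hφ a ha; omega)
      obtain ⟨γ, hγ, hγa⟩ := hP3 k a this
      exact ⟨γ, Finset.mem_filter.2 ⟨hγ, a, ha, hγa⟩, hγa⟩
  -- The multiplicity of a family is the number of levels at which it occurs.
  refine ⟨fun G => ((Finset.range n).filter fun k => Γ k = G).card, ?_, ?_⟩
  · rw [Finset.mem_piAntidiag]
    constructor
    · have := sum_fiber_card_mul hΓ fun _ => 1
      simp only [mul_one, Finset.sum_const, Finset.card_range, nsmul_eq_mul] at this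
      exact_mod_cast this
    · intro G hG
      obtain ⟨k, hk⟩ := Finset.card_pos.1 (Nat.pos_of_ne_zero hG)
      rw [← (Finset.mem_filter.1 hk).2]
      exact hΓ k (Finset.mem_range.1 (Finset.mem_filter.1 hk).1)
  · rw [sum_fiber_card_mul hΓ fun G => (totalLength G : ℤ)]
    simp only [sum_fiber_card_mul hΓ fun G => depth G _]
    have hlen : ∑ k ∈ Finset.range n, (totalLength (Γ k) : ℤ) = ∑ e ∈ touching Λ,
        ∑ k ∈ Finset.range n, ∑ γ ∈ Γ k, if dualEdge e ∈ γ then 1 else 0 := by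
      rw [Finset.sum_comm]
      refine Finset.sum_congr rfl fun k _ => ?_
      rw [Finset.sum_comm, totalLength, Nat.cast_sum]
      exact Finset.sum_congr rfl fun γ hγ => (sum_touching_mem (hsub k γ hγ)).symm
    rw [hlen, energy, energy, ← Finset.sum_add_distrib]
    refine Finset.sum_congr rfl fun e _ => ?_
    simp only [depth]
    refine abs_sub_eq_of_levels n _ _ Γ (fun γ => dualEdge e ∈ γ) (fun γ => e.1 ∈ inside γ)
      (fun γ => tgt e ∈ inside γ) ?_ ?_ ?_
    · intro k _ γ hγ hD
      have := (hP1 k γ (Finset.mem_filter.1 hγ).1).2 e hD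
      rwa [hlev, hlev] at this
    · intro k _ γ hγ
      exact (hP1 k γ (Finset.mem_filter.1 hγ).1).1.mem_iff e
    · intro k _ γ hγ γ' hγ' hD hD'
      exact hP2 k γ (Finset.mem_filter.1 hγ).1 γ' (Finset.mem_filter.1 hγ').1 e hD hD'

/-- Substituting φ - g for φ extracts e^(-βc) and leaves the partition function with boundary
condition -g ≤ 0, which the one with zero boundary condition dominates. -/
theorem tsum_indicator_le_of_energy_eq {β : ℝ} (hβ : 0 < β) (g : ℤ × ℤ → ℤ) (c : ℤ) (N : ℕ)
    (hg : ∀ x, 0 ≤ g x ∧ g x ≤ N) :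
    ∑' φ : Λ → ℤ, {φ : Λ → ℤ | energy Λ (extend φ 0) =
        energy Λ (fun x => extend φ 0 x - g x) + c}.indicator (weight Λ β) φ ≤
      ENNReal.ofReal (Real.exp (-β * c)) * partitionFunction Λ β := by
  calc _ ≤ ∑' φ : Λ → ℤ, ENNReal.ofReal (Real.exp (-β * c)) *
        ENNReal.ofReal (bdryWeight Λ β (fun x => -g x) (φ - fun x : Λ => g x)) := by
        refine ENNReal.tsum_le_tsum fun φ => ?_
        by_cases h : φ ∈ {φ : Λ → ℤ | energy Λ (extend φ 0) =
          energy Λ (fun x => extend φ 0 x - g x) + c}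
        · rw [Set.indicator_of_mem h, weight_eq, ← ENNReal.ofReal_mul (Real.exp_pos _).le]
          refine ENNReal.ofReal_le_ofReal (le_of_eq ?_)
          have h1 : extend (φ - fun x : Λ => g x) (fun x => -g x) =
              fun x => extend φ 0 x - g x := by
            funext x
            by_cases hx : x ∈ Λ <;> simp [extend, hx]
          have h2 : energy Λ (extend φ 0) = energy Λ (fun x => extend φ 0 x - g x) + c := h
          rw [bdryWeight, bdryWeight, h1, h2, ← Real.exp_add]
          push_cast
          ring_nf
        · rw [Set.indicator_of_notMem h]
          exact zero_le
    _ = ENNReal.ofReal (Real.exp (-β * c)) * bdryPartition Λ β fun x => -g x := by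
        rw [ENNReal.tsum_mul_left, bdryPartition]
        congr 1
        exact (Equiv.subRight (fun x : Λ => g x)).tsum_eq fun φ =>
          ENNReal.ofReal (bdryWeight Λ β (fun x => -g x) φ)
    _ ≤ _ := by
        rw [partitionFunction_eq]
        gcongr
        refine bdryPartition_le_zero hβ N _ (fun x => ?_) fun x => ?_ <;> have := hg x <;> omega

/-- The probability that the heights on `A` are at least `n` is bounded by a sum over multisets of
`n` families of contours around `A`. -/
theorem sosMeasure_real_le_sum {β : ℝ} (hβ : 0 < β) (n : ℕ) (A : Finset (ℤ × ℤ)) :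
    (sosMeasure Λ β).real {φ | ∀ a ∈ A, (n : ℤ) ≤ extend φ 0 a} ≤
      ∑ M ∈ Finset.piAntidiag (coverings Λ A) n,
        ∏ Γ ∈ coverings Λ A, Real.exp (-β * totalLength Γ) ^ M Γ := by
  classical
  have hpos : ∀ M : Finset (Finset (Sym2 (ℤ × ℤ))) → ℕ,
      0 ≤ ∏ Γ ∈ coverings Λ A, Real.exp (-β * totalLength Γ) ^ M Γ := fun M =>
    Finset.prod_nonneg fun Γ _ => pow_nonneg (Real.exp_pos _).le _
  refine sosMeasure_real_le hβ (Finset.sum_nonneg fun M _ => hpos M) ?_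
  rw [ENNReal.ofReal_sum_of_nonneg fun M _ => hpos M, Finset.sum_mul]
  let EM : (Finset (Finset (Sym2 (ℤ × ℤ))) → ℕ) → Set (Λ → ℤ) := fun M =>
    {φ | energy Λ (extend φ 0) =
        energy Λ (fun x => extend φ 0 x - ∑ Γ ∈ coverings Λ A, (M Γ : ℤ) * depth Γ x) +
        ∑ Γ ∈ coverings Λ A, (M Γ : ℤ) * totalLength Γ}
  calc _ ≤ ∑' φ : Λ → ℤ, ∑ M ∈ Finset.piAntidiag (coverings Λ A) n,
        (EM M).indicator (weight Λ β) φ := by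
        refine ENNReal.tsum_le_tsum fun φ => ?_
        by_cases h : φ ∈ {φ : Λ → ℤ | ∀ a ∈ A, (n : ℤ) ≤ extend φ 0 a}
        · obtain ⟨M, hM, hE⟩ := exists_energy_eq n A φ h
          rw [Set.indicator_of_mem h]
          refine le_trans (le_of_eq ?_) (Finset.single_le_sum
            (f := fun M => (EM M).indicator (weight Λ β) φ) (fun _ _ => zero_le) hM)
          exact (Set.indicator_of_mem (show φ ∈ EM M from hE) _).symm
        · rw [Set.indicator_of_notMem h]
          exact zero_le
    _ = ∑ M ∈ Finset.piAntidiag (coverings Λ A) n,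
        ∑' φ : Λ → ℤ, (EM M).indicator (weight Λ β) φ :=
        Summable.tsum_finsetSum fun _ _ => ENNReal.summable
    _ ≤ _ := by
        refine Finset.sum_le_sum fun M _ => ?_
        refine (tsum_indicator_le_of_energy_eq (Λ := Λ) hβ
          (fun x => ∑ Γ ∈ coverings Λ A, (M Γ : ℤ) * depth Γ x)
          (∑ Γ ∈ coverings Λ A, (M Γ : ℤ) * totalLength Γ)
          (∑ Γ ∈ coverings Λ A, M Γ * Γ.card) fun x => ⟨?_, ?_⟩).trans (le_of_eq ?_)
        · exact Finset.sum_nonneg fun Γ _ => mul_nonneg (Nat.cast_nonneg _) (depth_nonneg Γ x)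
        · push_cast
          exact Finset.sum_le_sum fun Γ _ =>
            mul_le_mul_of_nonneg_left (depth_le_card Γ x) (Nat.cast_nonneg _)
        · congr 2
          push_cast
          rw [Finset.mul_sum, Real.exp_sum]
          refine Finset.prod_congr rfl fun Γ _ => ?_
          rw [← Real.exp_nat_mul]
          ring_nf

end

/-! ### Sums over multisets -/

theorem sum_piAntidiag_insert {α : Type*} [DecidableEq α] {s : Finset α} {i : α} (hi : i ∉ s)
    (b : α → ℝ) (n : ℕ) :
    ∑ M ∈ Finset.piAntidiag (insert i s) n, ∏ j ∈ insert i s, b j ^ M j =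
      ∑ p ∈ Finset.HasAntidiagonal.antidiagonal n, b i ^ p.1 *
        ∑ M ∈ Finset.piAntidiag s p.2, ∏ j ∈ s, b j ^ M j := by
  rw [← Finset.cons_eq_insert i s hi, Finset.piAntidiag_cons hi, Finset.sum_disjiUnion]
  refine Finset.sum_congr rfl fun p _ => ?_
  rw [Finset.mul_sum, Finset.sum_map]
  refine Finset.sum_congr rfl fun M hM => ?_
  have hMi : M i = 0 := by
    by_contra h
    exact hi ((Finset.mem_piAntidiag.1 hM).2 i h)
  rw [Finset.prod_cons]
  simp only [addRightEmbedding_apply, Pi.add_apply, hMi, if_true, zero_add]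
  congr 1
  refine Finset.prod_congr rfl fun j hj => ?_
  rw [if_neg (by rintro rfl; exact hi hj), add_zero]

/-- The sum over multisets of size n is the coefficient of X^n in the product of the series 1 / (1 -
b_i X); partial sums of coefficients are at most the value at X = 1. -/
theorem sum_range_sum_piAntidiag_le {α : Type*} [DecidableEq α] (s : Finset α) (b : α → ℝ)
    (hb : ∀ i ∈ s, 0 ≤ b i ∧ b i < 1) (N : ℕ) :
    ∑ n ∈ Finset.range N, ∑ M ∈ Finset.piAntidiag s n, ∏ j ∈ s, b j ^ M j ≤
      ∏ i ∈ s, (1 - b i)⁻¹ := by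
  induction s using Finset.induction_on with
  | empty =>
    rcases N with _ | N
    · simp
    · rw [Finset.sum_range_succ']
      simp
  | insert i s hi ih =>
    have ih := ih fun j hj => hb j (Finset.mem_insert_of_mem hj)
    have hbi := hb i (Finset.mem_insert_self i s)
    have hpos : ∀ n, 0 ≤ ∑ M ∈ Finset.piAntidiag s n, ∏ j ∈ s, b j ^ M j := fun n =>
      Finset.sum_nonneg fun M _ => Finset.prod_nonneg fun j hj =>
        pow_nonneg (hb j (Finset.mem_insert_of_mem hj)).1 _
    simp only [sum_piAntidiag_insert hi]
    calc _ ≤ ∑ p ∈ Finset.range N ×ˢ Finset.range N, b i ^ p.1 *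
          ∑ M ∈ Finset.piAntidiag s p.2, ∏ j ∈ s, b j ^ M j := by
          rw [← Finset.sum_biUnion]
          · refine Finset.sum_le_sum_of_subset_of_nonneg ?_
              fun p _ _ => mul_nonneg (pow_nonneg hbi.1 _) (hpos _)
            intro p hp
            obtain ⟨n, hn, hp⟩ := Finset.mem_biUnion.1 hp
            rw [Finset.HasAntidiagonal.mem_antidiagonal] at hp
            rw [Finset.mem_range] at hn
            rw [Finset.mem_product, Finset.mem_range, Finset.mem_range]
            omega
          · intro m _ n _ hmn
            refine Finset.disjoint_left.2 fun p hp hp' => hmn ?_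
            rw [Finset.HasAntidiagonal.mem_antidiagonal] at hp hp'
            omega
      _ = (∑ k ∈ Finset.range N, b i ^ k) *
          ∑ n ∈ Finset.range N, ∑ M ∈ Finset.piAntidiag s n, ∏ j ∈ s, b j ^ M j := by
          rw [Finset.sum_product, Finset.sum_mul]
          refine Finset.sum_congr rfl fun k _ => ?_
          rw [Finset.mul_sum]
      _ ≤ (1 - b i)⁻¹ * ∏ j ∈ s, (1 - b j)⁻¹ := by
          have h1 : ∑ k ∈ Finset.range N, b i ^ k ≤ (1 - b i)⁻¹ := by
            rw [← tsum_geometric_of_lt_one hbi.1 hbi.2]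
            exact (summable_geometric_of_lt_one hbi.1 hbi.2).sum_le_tsum _
              fun k _ => pow_nonneg hbi.1 k
          exact mul_le_mul h1 ih (Finset.sum_nonneg fun n _ => hpos n)
            (inv_nonneg.2 (by linarith))
      _ = _ := by rw [Finset.prod_insert hi]

/-- The first index of weight 1 turns a coefficient into a partial sum, at no cost; each further one
sums at most n + 1 terms. With `t` empty the truncated exponent is 0, and one coefficient is bounded
by a partial sum. -/
theorem sum_piAntidiag_le {α : Type*} [DecidableEq α] (t s : Finset α) (hts : Disjoint t s)
    (b : α → ℝ) (hb : ∀ i ∈ s, 0 ≤ b i ∧ b i < 1) (hb' : ∀ i ∈ t, b i = 1) (n : ℕ) :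
    ∑ M ∈ Finset.piAntidiag (t ∪ s) n, ∏ j ∈ t ∪ s, b j ^ M j ≤
      (n + 1) ^ (t.card - 1) * ∏ i ∈ s, (1 - b i)⁻¹ := by
  have hD : 0 ≤ ∏ i ∈ s, (1 - b i)⁻¹ := Finset.prod_nonneg fun i hi =>
    inv_nonneg.2 (by linarith [(hb i hi).2])
  have hpart := sum_range_sum_piAntidiag_le s b hb
  induction t using Finset.induction_on generalizing n with
  | empty =>
    simp only [Finset.empty_union, Finset.card_empty, zero_tsub, pow_zero, one_mul]
    refine le_trans ?_ (hpart (n + 1))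
    exact Finset.single_le_sum
      (f := fun n => ∑ M ∈ Finset.piAntidiag s n, ∏ j ∈ s, b j ^ M j)
      (fun k _ => Finset.sum_nonneg fun M _ => Finset.prod_nonneg fun j hj =>
        pow_nonneg (hb j hj).1 _) (Finset.self_mem_range_succ n)
  | insert i t hi ih =>
    have hts' : Disjoint t s := Finset.disjoint_of_subset_left (Finset.subset_insert i t) hts
    have hi' : i ∉ t ∪ s := by
      rw [Finset.mem_union, not_or]
      exact ⟨hi, Finset.disjoint_left.1 hts (Finset.mem_insert_self i t)⟩
    have ih := fun n => ih hts' (fun j hj => hb' j (Finset.mem_insert_of_mem hj)) n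
    rw [Finset.insert_union, sum_piAntidiag_insert hi', hb' i (Finset.mem_insert_self i t)]
    simp only [one_pow, one_mul]
    rw [← Finset.Nat.sum_antidiagonal_swap, Finset.Nat.sum_antidiagonal_eq_sum_range_succ_mk]
    simp only [Prod.swap_prod_mk]
    rcases t.eq_empty_or_nonempty with rfl | ht
    · simpa using hpart (n + 1)
    · refine (Finset.sum_le_card_nsmul _ _ ((n + 1) ^ (t.card - 1) * ∏ i ∈ s, (1 - b i)⁻¹)
        fun k hk => (ih k).trans ?_).trans (le_of_eq ?_)
      · have : (k : ℝ) ≤ n := by exact_mod_cast Nat.lt_succ_iff.1 (Finset.mem_range.1 hk)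
        gcongr
      · have := Finset.card_pos.2 ht
        rw [Finset.card_insert_of_notMem hi, Finset.card_range, nsmul_eq_mul, ← mul_assoc,
          show t.card + 1 - 1 = (t.card - 1) + 1 by omega, pow_succ']
        push_cast
        ring

theorem prod_inv_one_sub_le {α : Type*} (s : Finset α) (b : α → ℝ) {q : ℝ} (hq : q < 1)
    (hb : ∀ i ∈ s, 0 ≤ b i ∧ b i ≤ q) :
    ∏ i ∈ s, (1 - b i)⁻¹ ≤ Real.exp ((∑ i ∈ s, b i) / (1 - q)) := by
  rw [Finset.sum_div, Real.exp_sum]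
  refine Finset.prod_le_prod (fun i hi => inv_nonneg.2 (by linarith [(hb i hi).2])) fun i hi => ?_
  have h1 := hb i hi
  have h2 : 0 < 1 - b i := by linarith
  have h3 : b i / (1 - b i) ≤ b i / (1 - q) := by
    have h4 : 0 < 1 - q := by linarith
    gcongr
    · exact h1.1
    · exact h1.2
  calc (1 - b i)⁻¹ = b i / (1 - b i) + 1 := by field_simp; ring
    _ ≤ Real.exp (b i / (1 - b i)) := Real.add_one_le_exp _
    _ ≤ _ := Real.exp_le_exp.2 h3

/-! ### Translation of contours -/

/-- The translate of a set of dual edges by `-a`. -/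
def translate (a : ℤ × ℤ) (γ : Finset (Sym2 (ℤ × ℤ))) : Finset (Sym2 (ℤ × ℤ)) :=
  γ.image (Sym2.map (· - a))

theorem sym2_map_sub_injective (a : ℤ × ℤ) : Function.Injective (Sym2.map (· - a)) :=
  Sym2.map.injective sub_left_injective

theorem adj_sub_iff {p q a : ℤ × ℤ} : Adj (p - a) (q - a) ↔ Adj p q := by
  simp [Adj]

theorem mem_sym2_map_sub {a p : ℤ × ℤ} {e : Sym2 (ℤ × ℤ)} :
    p ∈ Sym2.map (· - a) e ↔ p + a ∈ e := by
  rw [Sym2.mem_map]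
  constructor
  · rintro ⟨q, hq, rfl⟩
    simpa using hq
  · intro h
    exact ⟨_, h, by simp⟩

theorem LinkedAt.translate {p a : ℤ × ℤ} {e f : Sym2 (ℤ × ℤ)} (h : LinkedAt (p + a) e f) :
    LinkedAt p (Sym2.map (· - a) e) (Sym2.map (· - a) f) := by
  obtain ⟨q, r, h1, h2, h3, rfl, rfl, h4⟩ := h
  refine ⟨q - a, r - a, ?_, ?_, by simpa using h3, by simp, by simp, ?_⟩
  · rw [← adj_sub_iff (a := a)] at h1
    simpa using h1
  · rw [← adj_sub_iff (a := a)] at h2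
    simpa using h2
  · have : ∀ q, side p (q - a) = side (p + a) q := by
      intro q
      simp only [side, Prod.fst_sub, Prod.snd_sub, Prod.fst_add, Prod.snd_add]
      ring
    rw [this, this]
    exact h4

theorem IsGeometricContour.translate {γ : Finset (Sym2 (ℤ × ℤ))} (h : IsGeometricContour γ)
    (a : ℤ × ℤ) : IsGeometricContour (translate a γ) := by
  obtain ⟨n, e, he, hγ⟩ := h
  refine ⟨n, fun i => Sym2.map (· - a) (e i), ⟨he.three_le, ?_, ?_, ?_, ?_⟩, ?_⟩
  · intro i
    obtain ⟨p, q, hpq, h⟩ := he.dualEdge i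
    exact ⟨p - a, q - a, adj_sub_iff.2 hpq, by simp [h]⟩
  · exact (sym2_map_sub_injective a).comp he.injective
  · intro i
    obtain ⟨p, h1, h2⟩ := he.consecutive i
    exact ⟨p - a, mem_sym2_map_sub.2 (by simpa using h1), mem_sym2_map_sub.2 (by simpa using h2)⟩
  · intro i j hij p h1 h2 h3 h4
    rw [mem_sym2_map_sub] at h1 h2 h3 h4
    obtain ⟨h5, h6⟩ := he.linked i j hij (p + a) h1 h2 h3 h4
    exact ⟨h5.translate, h6.translate⟩
  · rw [SOS.translate, Finset.coe_image, hγ, ← Set.range_comp]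
    rfl

theorem mem_inside_translate {γ : Finset (Sym2 (ℤ × ℤ))} {a x : ℤ × ℤ} :
    x ∈ inside (translate a γ) ↔ x + a ∈ inside γ := by
  classical
  simp only [inside, Set.mem_ofPred_eq, translate]
  rw [Finset.filter_image, Finset.card_image_of_injective _ (sym2_map_sub_injective a)]
  have : ∀ (k : ℕ) (e : Sym2 (ℤ × ℤ)), Sym2.map (· - a) e = crossingEdge (x.1 + k) x.2 ↔
      e = crossingEdge ((x + a).1 + k) (x + a).2 := by
    intro k e
    have h : crossingEdge (x.1 + k) x.2 =
        Sym2.map (· - a) (crossingEdge ((x + a).1 + k) (x + a).2) := by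
      simp only [crossingEdge, Sym2.map_mk]
      refine congrArg₂ (fun p q => s(p, q)) ?_ ?_ <;> ext <;> simp <;> ring
    rw [h, (sym2_map_sub_injective a).eq_iff]
  simp only [this]

/-- The sum over the contours around the origin. -/
noncomputable def contourSum (β : ℝ) : ℝ :=
  ∑' γ : {γ : Contour // ((0, 0) : ℤ × ℤ) ∈ γ.interior}, Real.exp (-β * (γ.1.length : ℝ))

theorem sum_exp_le_contourSum {β : ℝ} (hsum : ContourSummable β)
    (U : Finset (Finset (Sym2 (ℤ × ℤ)))) (a : ℤ × ℤ)
    (hU : ∀ γ ∈ U, IsGeometricContour γ ∧ a ∈ inside γ) :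
    ∑ γ ∈ U, Real.exp (-β * (γ.card : ℝ)) ≤ contourSum β := by
  let i : U → {γ : Contour // ((0, 0) : ℤ × ℤ) ∈ γ.interior} := fun γ =>
    ⟨⟨translate a γ, (hU γ γ.2).1.translate a, 1⟩, by
      have h : ((0, 0) : ℤ × ℤ) ∈ inside (translate a γ) :=
        mem_inside_translate.2 (by
          rw [show ((0, 0) : ℤ × ℤ) + a = a from zero_add a]
          exact (hU γ γ.2).2)
      exact h⟩
  have hi : Function.Injective i := by
    intro γ γ' h
    have h' : translate a γ = translate a γ' := congrArg (fun c => c.1.edges) h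
    exact Subtype.ext (Finset.image_injective (sym2_map_sub_injective a) h')
  have hlen : ∀ γ, (i γ).1.length = (γ : Finset (Sym2 (ℤ × ℤ))).card := fun γ =>
    Finset.card_image_of_injective _ (sym2_map_sub_injective a)
  rw [← Finset.sum_coe_sort U]
  calc _ = ∑ c ∈ Finset.univ.map ⟨i, hi⟩, Real.exp (-β * (c.1.length : ℝ)) := by
        rw [Finset.sum_map]
        simp [hlen]
    _ ≤ _ := hsum.sum_le_tsum _ fun _ _ => (Real.exp_pos _).le

theorem contourSum_nonneg (β : ℝ) : 0 ≤ contourSum β := tsum_nonneg fun _ => (Real.exp_pos _).le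

/-- Summing over all families of contours around points of `A` gives the product of 1 + e^(-β|γ|),
at most the exponential of the sum of e^(-β|γ|). By translation each point of `A` contributes at
most `contourSum β` to that sum, whatever Λ is. -/
theorem sum_coverings_le {β : ℝ} (hsum : ContourSummable β) (Λ A : Finset (ℤ × ℤ)) :
    ∑ Γ ∈ coverings Λ A, Real.exp (-β * totalLength Γ) ≤ Real.exp (A.card * contourSum β) := by
  classical
  have h1 : ∑ γ ∈ enclosing Λ A, Real.exp (-β * (γ.card : ℝ)) ≤ A.card * contourSum β := by
    rw [← nsmul_eq_mul]
    calc _ ≤ ∑ γ ∈ enclosing Λ A, ∑ a ∈ A,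
          if a ∈ inside γ then Real.exp (-β * (γ.card : ℝ)) else 0 := by
          refine Finset.sum_le_sum fun γ hγ => ?_
          obtain ⟨a, ha, haγ⟩ := (Finset.mem_filter.1 hγ).2.2
          refine le_trans (le_of_eq ?_) (Finset.single_le_sum (fun b _ => ?_) ha)
          · rw [if_pos haγ]
          · split_ifs
            exacts [(Real.exp_pos _).le, le_rfl]
      _ = ∑ a ∈ A, ∑ γ ∈ (enclosing Λ A).filter (a ∈ inside ·),
          Real.exp (-β * (γ.card : ℝ)) := by
          rw [Finset.sum_comm]
          simp only [Finset.sum_filter]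
      _ ≤ _ := Finset.sum_le_card_nsmul _ _ _ fun a _ => sum_exp_le_contourSum hsum _ a
          fun γ hγ => ⟨(Finset.mem_filter.1 (Finset.mem_filter.1 hγ).1).2.1.isGeometricContour,
            (Finset.mem_filter.1 hγ).2⟩
  calc _ ≤ ∑ Γ ∈ (enclosing Λ A).powerset, Real.exp (-β * totalLength Γ) :=
        Finset.sum_le_sum_of_subset_of_nonneg (Finset.filter_subset _ _)
          fun _ _ _ => (Real.exp_pos _).le
    _ = ∏ γ ∈ enclosing Λ A, (1 + Real.exp (-β * (γ.card : ℝ))) := by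
        rw [Finset.prod_one_add]
        refine Finset.sum_congr rfl fun Γ _ => ?_
        rw [← Real.exp_sum, ← Finset.mul_sum, totalLength]
        push_cast
        rfl
    _ ≤ ∏ γ ∈ enclosing Λ A, Real.exp (Real.exp (-β * (γ.card : ℝ))) := by
        refine Finset.prod_le_prod (fun γ _ => by positivity) fun γ _ => ?_
        rw [add_comm]
        exact Real.add_one_le_exp _
    _ = Real.exp (∑ γ ∈ enclosing Λ A, Real.exp (-β * (γ.card : ℝ))) := (Real.exp_sum _ _).symm
    _ ≤ _ := Real.exp_le_exp.2 h1

section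

variable {Λ : Finset (ℤ × ℤ)}

/-! ### Upper bounds -/

/-- The constant in the upper bounds. -/
noncomputable def upperConst (β : ℝ) : ℝ :=
  Real.exp (Real.exp (8 * β) * Real.exp (3 * contourSum β) / (1 - Real.exp (-β)))

/-- With e^(-βl) taken out of each of the n families, the weights `b` are 1 for minimal families and
at most e^(-β) for the others, since lengths are integers. In `upperConst`, the 8 bounds l and the 3
bounds |A|. -/
theorem sosMeasure_real_le_of_coverings {β : ℝ} (hβ : 0 < β) (hsum : ContourSummable β)
    (A : Finset (ℤ × ℤ)) (hA : A.card ≤ 3) (l r n : ℕ) (hl : l ≤ 8)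
    (h1 : ∀ Γ ∈ coverings Λ A, l ≤ totalLength Γ)
    (h2 : ((coverings Λ A).filter (totalLength · = l)).card ≤ r) :
    (sosMeasure Λ β).real {φ | ∀ a ∈ A, (n : ℤ) ≤ extend φ 0 a} ≤
      (n + 1) ^ (r - 1) * upperConst β * Real.exp (-l * β * n) := by
  classical
  refine (sosMeasure_real_le_sum hβ n A).trans ?_
  let b : Finset (Finset (Sym2 (ℤ × ℤ))) → ℝ := fun Γ =>
    Real.exp (-β * ((totalLength Γ : ℝ) - l))
  have hq : Real.exp (-β) < 1 := by simpa using hβ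
  have hb : ∀ Γ ∈ (coverings Λ A).filter (¬ totalLength · = l), 0 ≤ b Γ ∧ b Γ ≤ Real.exp (-β) := by
    intro Γ hΓ
    obtain ⟨hΓ, hne⟩ := Finset.mem_filter.1 hΓ
    refine ⟨(Real.exp_pos _).le, Real.exp_le_exp.2 ?_⟩
    have h3 : (l : ℝ) + 1 ≤ totalLength Γ := by
      exact_mod_cast lt_of_le_of_ne (h1 Γ hΓ) (Ne.symm hne)
    nlinarith
  have hfactor : ∀ M ∈ Finset.piAntidiag (coverings Λ A) n,
      ∏ Γ ∈ coverings Λ A, Real.exp (-β * totalLength Γ) ^ M Γ =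
        Real.exp (-l * β * n) * ∏ Γ ∈ coverings Λ A, b Γ ^ M Γ := by
    intro M hM
    have hn : (n : ℝ) = ∑ Γ ∈ coverings Λ A, (M Γ : ℝ) := by
      rw [← (Finset.mem_piAntidiag.1 hM).1]
      push_cast
      rfl
    rw [hn, Finset.mul_sum, Real.exp_sum, ← Finset.prod_mul_distrib]
    refine Finset.prod_congr rfl fun Γ _ => ?_
    rw [← Real.exp_nat_mul, ← Real.exp_nat_mul, ← Real.exp_add]
    ring_nf
  rw [Finset.sum_congr rfl hfactor, ← Finset.mul_sum, mul_comm]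
  refine mul_le_mul_of_nonneg_right ?_ (Real.exp_pos _).le
  have hsplit := Finset.filter_union_filter_not_eq (totalLength · = l) (coverings Λ A)
  have h3 := sum_piAntidiag_le _ _ (Finset.disjoint_filter_filter_not (coverings Λ A)
    (coverings Λ A) (totalLength · = l)) b
    (fun Γ hΓ => ⟨(hb Γ hΓ).1, (hb Γ hΓ).2.trans_lt hq⟩)
    (fun Γ hΓ => by simp [b, (Finset.mem_filter.1 hΓ).2]) n
  rw [hsplit] at h3
  refine h3.trans (mul_le_mul ?_ ?_ ?_ (by positivity))
  · refine pow_le_pow_right₀ ?_ (by omega)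
    linarith [Nat.cast_nonneg (α := ℝ) n]
  · refine (prod_inv_one_sub_le _ b hq hb).trans (Real.exp_le_exp.2 ?_)
    refine div_le_div_of_nonneg_right ?_ (by linarith)
    calc _ ≤ ∑ Γ ∈ coverings Λ A, b Γ :=
          Finset.sum_le_sum_of_subset_of_nonneg (Finset.filter_subset _ _)
            fun _ _ _ => (Real.exp_pos _).le
      _ = Real.exp (l * β) * ∑ Γ ∈ coverings Λ A, Real.exp (-β * totalLength Γ) := by
          rw [Finset.mul_sum]
          refine Finset.sum_congr rfl fun Γ _ => ?_
          rw [← Real.exp_add]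
          simp only [b]
          ring_nf
      _ ≤ _ := by
          have h4 : (l : ℝ) ≤ 8 := by exact_mod_cast hl
          have h5 : (A.card : ℝ) ≤ 3 := by exact_mod_cast hA
          have h6 := contourSum_nonneg β
          refine mul_le_mul (Real.exp_le_exp.2 (by nlinarith))
            ((sum_coverings_le hsum Λ A).trans (Real.exp_le_exp.2 (by nlinarith)))
            (Finset.sum_nonneg fun _ _ => (Real.exp_pos _).le) (Real.exp_pos _).le
  · exact Finset.prod_nonneg fun Γ hΓ =>
      inv_nonneg.2 (by linarith [(hb Γ hΓ).2])

variable {A : Finset (ℤ × ℤ)} {Γ : Finset (Finset (Sym2 (ℤ × ℤ)))}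

open Classical in
theorem isSeparating_of_mem_coverings (hΓ : Γ ∈ coverings Λ A) {γ : Finset (Sym2 (ℤ × ℤ))}
    (hγ : γ ∈ Γ) : IsSeparating γ :=
  (Finset.mem_filter.1 (Finset.mem_powerset.1 (Finset.mem_filter.1 hΓ).1 hγ)).2.1

open Classical in
theorem exists_mem_inside_of_mem_coverings (hΓ : Γ ∈ coverings Λ A) {a : ℤ × ℤ} (ha : a ∈ A) :
    ∃ γ ∈ Γ, a ∈ inside γ := (Finset.mem_filter.1 hΓ).2 a ha

open Classical in
theorem four_le_card_of_mem_coverings (hΓ : Γ ∈ coverings Λ A) {γ : Finset (Sym2 (ℤ × ℤ))}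
    (hγ : γ ∈ Γ) : 4 ≤ γ.card := by
  obtain ⟨h, a, -, ha⟩ :=
    (Finset.mem_filter.1 (Finset.mem_powerset.1 (Finset.mem_filter.1 hΓ).1 hγ)).2
  exact (h.card_of_mem ha).1

theorem card_le_totalLength {γ : Finset (Sym2 (ℤ × ℤ))} (hγ : γ ∈ Γ) :
    γ.card ≤ totalLength Γ :=
  Finset.single_le_sum (f := Finset.card) (fun _ _ => Nat.zero_le _) hγ

theorem card_add_card_le_totalLength {γ γ' : Finset (Sym2 (ℤ × ℤ))} (hγ : γ ∈ Γ) (hγ' : γ' ∈ Γ)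
    (hne : γ ≠ γ') : γ.card + γ'.card ≤ totalLength Γ := by
  classical
  rw [← Finset.sum_pair (f := Finset.card) hne]
  exact Finset.sum_le_sum_of_subset (by
    intro x hx
    rcases Finset.mem_insert.1 hx with rfl | hx
    · exact hγ
    · rwa [Finset.mem_singleton.1 hx])

theorem card_add_card_add_card_le_totalLength {γ₁ γ₂ γ₃ : Finset (Sym2 (ℤ × ℤ))} (h₁ : γ₁ ∈ Γ)
    (h₂ : γ₂ ∈ Γ) (h₃ : γ₃ ∈ Γ) (h₁₂ : γ₁ ≠ γ₂) (h₁₃ : γ₁ ≠ γ₃) (h₂₃ : γ₂ ≠ γ₃) :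
    γ₁.card + γ₂.card + γ₃.card ≤ totalLength Γ := by
  classical
  have h : γ₁ ∉ ({γ₂, γ₃} : Finset (Finset (Sym2 (ℤ × ℤ)))) := by simp [h₁₂, h₁₃]
  rw [add_assoc, ← Finset.sum_pair (f := Finset.card) h₂₃,
    ← Finset.sum_insert (f := Finset.card) h]
  exact Finset.sum_le_sum_of_subset (by
    intro x hx
    simp only [Finset.mem_insert, Finset.mem_singleton] at hx
    rcases hx with rfl | rfl | rfl <;> assumption)

/-- The upper bound when the families of minimal length consist of a single contour, whose
interior is one of the sets of `T`. -/
theorem sosMeasure_real_le_of_minimal {β : ℝ} (hβ : 0 < β) (hsum : ContourSummable β)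
    (A : Finset (ℤ × ℤ)) (hA : A.card ≤ 3) (l n : ℕ) (hl : l ≤ 8) (T : Finset (Set (ℤ × ℤ)))
    (h1 : ∀ γ, IsSeparating γ → (∀ a ∈ A, a ∈ inside γ) →
      l ≤ γ.card ∧ (γ.card = l → inside γ ∈ T))
    (h2 : ∀ Γ ∈ coverings Λ A, totalLength Γ ≤ l → ∃ γ ∈ Γ, ∀ a ∈ A, a ∈ inside γ) :
    (sosMeasure Λ β).real {φ | ∀ a ∈ A, (n : ℤ) ≤ extend φ 0 a} ≤
      (n + 1) ^ (T.card - 1) * upperConst β * Real.exp (-l * β * n) := by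
  classical
  have h3 : ∀ Γ ∈ coverings Λ A, l ≤ totalLength Γ := by
    intro Γ hΓ
    by_contra! h
    obtain ⟨γ, hγ, hA⟩ := h2 Γ hΓ h.le
    have := (h1 γ (isSeparating_of_mem_coverings hΓ hγ) hA).1
    have := card_le_totalLength hγ
    omega
  refine sosMeasure_real_le_of_coverings hβ hsum A hA l T.card n hl h3 ?_
  have h4 : ∀ Γ ∈ (coverings Λ A).filter (totalLength · = l), ∃ γ, Γ = {γ} ∧ IsSeparating γ ∧
      inside γ ∈ T := by
    intro Γ hΓ
    obtain ⟨hΓ, hlen⟩ := Finset.mem_filter.1 hΓ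
    obtain ⟨γ, hγ, hA⟩ := h2 Γ hΓ hlen.le
    have hs := isSeparating_of_mem_coverings hΓ hγ
    have h5 := h1 γ hs hA
    have h6 := card_le_totalLength hγ
    refine ⟨γ, Finset.eq_singleton_iff_unique_mem.2 ⟨hγ, fun γ' hγ' => ?_⟩, hs,
      h5.2 (by omega)⟩
    by_contra hne
    have := card_add_card_le_totalLength hγ' hγ hne
    have := four_le_card_of_mem_coverings hΓ hγ'
    omega
  -- A second contour would add at least 4 to the length, so a minimal family is a single contour,
  -- and a separating contour is determined by its interior.
  refine Finset.card_le_card_of_injOn (fun Γ => ⋃ γ ∈ Γ, inside γ) ?_ ?_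
  · intro Γ hΓ
    obtain ⟨γ, rfl, -, hT⟩ := h4 Γ hΓ
    simpa using hT
  · intro Γ hΓ Γ' hΓ' h
    obtain ⟨γ, rfl, hs, -⟩ := h4 Γ hΓ
    obtain ⟨γ', rfl, hs', -⟩ := h4 Γ' hΓ'
    simp only [Finset.mem_singleton, Set.iUnion_iUnion_eq_left] at h
    rw [hs.eq_of_inside_eq hs' h]

theorem sosMeasure_real_le_one {β : ℝ} (hβ : 0 < β) (hsum : ContourSummable β) (n : ℕ)
    (x : ℤ × ℤ) :
    (sosMeasure Λ β).real {φ | ∀ a ∈ ({x} : Finset (ℤ × ℤ)), (n : ℤ) ≤ extend φ 0 a} ≤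
      upperConst β * Real.exp (-4 * β * n) := by
  have h := sosMeasure_real_le_of_minimal (Λ := Λ) hβ hsum {x} (by simp) 4 n (by norm_num)
    {{x}} ?_ ?_
  · simpa using h
  · intro γ hγ hx
    have hx : x ∈ inside γ := hx x (by simp)
    have h := hγ.card_of_mem hx
    refine ⟨h.1, fun h' => ?_⟩
    rw [Finset.mem_singleton]
    ext z
    exact ⟨fun hz => h.2 h'.le z hz, fun hz => by rw [Set.mem_singleton_iff.1 hz]; exact hx⟩
  · intro Γ hΓ _
    obtain ⟨γ, hγ, hx⟩ := exists_mem_inside_of_mem_coverings hΓ (Finset.mem_singleton_self x)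
    exact ⟨γ, hγ, by simpa using hx⟩

theorem sosMeasure_real_le_two {β : ℝ} (hβ : 0 < β) (hsum : ContourSummable β) (n : ℕ)
    {x y : ℤ × ℤ} (hxy : Adj x y) :
    (sosMeasure Λ β).real {φ | ∀ a ∈ ({x, y} : Finset (ℤ × ℤ)), (n : ℤ) ≤ extend φ 0 a} ≤
      upperConst β * Real.exp (-6 * β * n) := by
  have h := sosMeasure_real_le_of_minimal (Λ := Λ) hβ hsum {x, y}
    (Finset.card_le_two.trans (by norm_num)) 6 n (by norm_num) {{x, y}} ?_ ?_
  · simpa using h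
  · intro γ hγ hA
    have hx : x ∈ inside γ := hA x (by simp)
    have hy : y ∈ inside γ := hA y (by simp)
    have h := hγ.card_of_mem_mem hx hy hxy
    refine ⟨h.1, fun h' => ?_⟩
    rw [Finset.mem_singleton]
    ext z
    exact ⟨fun hz => h.2 h'.le z hz, fun hz => by rcases hz with rfl | rfl <;> assumption⟩
  · intro Γ hΓ hlen
    obtain ⟨γ, hγ, hx⟩ := exists_mem_inside_of_mem_coverings hΓ (a := x) (by simp)
    obtain ⟨γ', hγ', hy⟩ := exists_mem_inside_of_mem_coverings hΓ (a := y) (by simp)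
    by_cases hne : γ = γ'
    · subst hne
      exact ⟨γ, hγ, by simp [hx, hy]⟩
    · have := card_add_card_le_totalLength hγ hγ' hne
      have := four_le_card_of_mem_coverings hΓ hγ
      have := four_le_card_of_mem_coverings hΓ hγ'
      omega

/-- Distinct contours would cost at least 6 + 4 if one of them encloses two neighbours, and 12 if
there are three. Two contours of length 4 do not suffice, as each encloses a single vertex. -/
theorem exists_inside_of_totalLength_le {x y z : ℤ × ℤ} (hxy : Adj x y) (hyz : Adj y z)
    (hxz : x ≠ z) (hΓ : Γ ∈ coverings Λ {x, y, z}) (hlen : totalLength Γ ≤ 8) :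
    ∃ γ ∈ Γ, ∀ a ∈ ({x, y, z} : Finset (ℤ × ℤ)), a ∈ inside γ := by
  obtain ⟨γ₁, h₁, hx⟩ := exists_mem_inside_of_mem_coverings hΓ (a := x) (by simp)
  obtain ⟨γ₂, h₂, hy⟩ := exists_mem_inside_of_mem_coverings hΓ (a := y) (by simp)
  obtain ⟨γ₃, h₃, hz⟩ := exists_mem_inside_of_mem_coverings hΓ (a := z) (by simp)
  have k₁ := four_le_card_of_mem_coverings hΓ h₁
  have k₂ := four_le_card_of_mem_coverings hΓ h₂
  have k₃ := four_le_card_of_mem_coverings hΓ h₃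
  have s₁ := isSeparating_of_mem_coverings hΓ h₁
  by_cases e₁₂ : γ₁ = γ₂
  · subst e₁₂
    by_cases e₁₃ : γ₁ = γ₃
    · subst e₁₃
      exact ⟨γ₁, h₁, by simp [hx, hy, hz]⟩
    · have := card_add_card_le_totalLength h₁ h₃ e₁₃
      have := (s₁.card_of_mem_mem hx hy hxy).1
      omega
  · by_cases e₂₃ : γ₂ = γ₃
    · subst e₂₃
      have := card_add_card_le_totalLength h₁ h₂ e₁₂
      have := ((isSeparating_of_mem_coverings hΓ h₂).card_of_mem_mem hy hz hyz).1
      omega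
    · by_cases e₁₃ : γ₁ = γ₃
      · subst e₁₃
        have := card_add_card_le_totalLength h₁ h₂ e₁₂
        exact absurd ((s₁.card_of_mem hx).2 (by omega) z hz).symm hxz
      · have := card_add_card_add_card_le_totalLength h₁ h₂ h₃ e₁₂ e₁₃ e₂₃
        omega

theorem sosMeasure_real_le_three {β : ℝ} (hβ : 0 < β) (hsum : ContourSummable β) (n : ℕ)
    {x y z : ℤ × ℤ} (hxy : Adj x y) (hyz : Adj y z) (hxz : x ≠ z) :
    (sosMeasure Λ β).real {φ | ∀ a ∈ ({x, y, z} : Finset (ℤ × ℤ)), (n : ℤ) ≤ extend φ 0 a} ≤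
      (n + 1) * upperConst β * Real.exp (-8 * β * n) := by
  classical
  -- Two interiors are possible at length 8: the triple itself, or the triple with the fourth corner
  -- x + z - y. Hence the exponent of n + 1 is at most 1.
  have h := sosMeasure_real_le_of_minimal (Λ := Λ) hβ hsum {x, y, z}
    Finset.card_le_three 8 n le_rfl {{x, y, z}, {x, y, z, x + z - y}} ?_
    fun Γ hΓ hlen => exists_inside_of_totalLength_le hxy hyz hxz hΓ hlen
  · refine h.trans ?_
    have hn : (1 : ℝ) ≤ n + 1 := by linarith [Nat.cast_nonneg (α := ℝ) n]
    have hp : ((n : ℝ) + 1) ^ (({{x, y, z}, {x, y, z, x + z - y}} :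
        Finset (Set (ℤ × ℤ))).card - 1) ≤ n + 1 := by
      refine (pow_le_pow_right₀ hn (?_ : _ ≤ 1)).trans (pow_one _).le
      have := Finset.card_le_two (a := ({x, y, z} : Set (ℤ × ℤ)))
        (b := ({x, y, z, x + z - y} : Set (ℤ × ℤ)))
      omega
    have : 0 ≤ upperConst β := (Real.exp_pos _).le
    push_cast
    gcongr
  · intro γ hγ hA
    have hx : x ∈ inside γ := hA x (by simp)
    have hy : y ∈ inside γ := hA y (by simp)
    have hz : z ∈ inside γ := hA z (by simp)
    have h := hγ.card_of_mem_mem_mem hx hy hz hxy hyz hxz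
    refine ⟨h.1, fun h' => ?_⟩
    rw [Finset.mem_insert, Finset.mem_singleton]
    have h2 := h.2 h'.le
    by_cases hw : x + z - y ∈ inside γ
    · right
      ext w
      exact ⟨fun hw => h2 w hw, fun hw => by rcases hw with rfl | rfl | rfl | rfl <;> assumption⟩
    · left
      ext w
      constructor
      · intro hw'
        rcases h2 w hw' with h | h | h | h
        · exact Or.inl h
        · exact Or.inr (Or.inl h)
        · exact Or.inr (Or.inr h)
        · exact absurd (h ▸ hw') hw
      · intro hw
        rcases hw with rfl | rfl | rfl <;> assumption

theorem sosMeasure_real_le_three_aligned {β : ℝ} (hβ : 0 < β) (hsum : ContourSummable β) (n : ℕ)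
    {x y z : ℤ × ℤ} (hxy : Adj x y) (hyz : Adj y z) (hxz : x ≠ z) (hal : x + z = y + y) :
    (sosMeasure Λ β).real {φ | ∀ a ∈ ({x, y, z} : Finset (ℤ × ℤ)), (n : ℤ) ≤ extend φ 0 a} ≤
      upperConst β * Real.exp (-8 * β * n) := by
  have h := sosMeasure_real_le_of_minimal (Λ := Λ) hβ hsum {x, y, z}
    Finset.card_le_three 8 n le_rfl {{x, y, z}} ?_
    fun Γ hΓ hlen => exists_inside_of_totalLength_le hxy hyz hxz hΓ hlen
  · simpa using h
  · intro γ hγ hA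
    have hx : x ∈ inside γ := hA x (by simp)
    have hy : y ∈ inside γ := hA y (by simp)
    have hz : z ∈ inside γ := hA z (by simp)
    have h := hγ.card_of_mem_mem_mem hx hy hz hxy hyz hxz
    refine ⟨h.1, fun h' => ?_⟩
    rw [Finset.mem_singleton]
    ext w
    constructor
    · intro hw
      have h2 := h.2 h'.le w hw
      -- For an aligned triple the candidate x + z - y is y itself, so only one interior is left and
      -- no factor n appears.
      rw [hal, add_sub_cancel_right] at h2
      rcases h2 with h | h | h | h
      · exact Or.inl h
      · exact Or.inr (Or.inl h)
      · exact Or.inr (Or.inr h)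
      · exact Or.inr (Or.inl h)
    · intro hw
      rcases hw with rfl | rfl | rfl <;> assumption

theorem exists_edge_of_adj {x y : ℤ × ℤ} (h : Adj x y) :
    ∃ e : (ℤ × ℤ) × Bool, (e.1 = x ∧ tgt e = y) ∨ (e.1 = y ∧ tgt e = x) := by
  have hy := mem_nbrs.2 h
  simp only [nbrs, Finset.mem_insert, Finset.mem_singleton] at hy
  obtain ⟨a, b⟩ := y
  rcases hy with rfl | rfl | rfl | rfl
  · exact ⟨((a, b), false), by simp [tgt, unitVec]⟩
  · exact ⟨((a - 1, b), false), by simp [tgt, unitVec]⟩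
  · exact ⟨((a, b), true), by simp [tgt, unitVec]⟩
  · exact ⟨((a, b - 1), true), by simp [tgt, unitVec]⟩

theorem Adj.ne {x y : ℤ × ℤ} (h : Adj x y) : x ≠ y := by
  rintro rfl
  simp [Adj] at h

end

end SOS

/-! ### The proposition -/

theorem proposition4p1 (β : ℝ) (hβ : 0 < β) (hsum : SOS.ContourSummable β) :
    ∃ C : ℝ, ∀ n : ℕ, 1 ≤ n → ∀ Λ : Finset (ℤ × ℤ),
      (∀ x : Λ,
        (1 / 2) * Real.exp (-4 * β * n) ≤ (SOS.sosMeasure Λ β).real {φ | (n : ℤ) ≤ φ x} ∧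
        (SOS.sosMeasure Λ β).real {φ | (n : ℤ) ≤ φ x} ≤ C * Real.exp (-4 * β * n)) ∧
      (∀ x y : Λ, SOS.Adj x y →
        (1 / 4) * Real.exp (-6 * β * n) ≤
          (SOS.sosMeasure Λ β).real {φ | (n : ℤ) ≤ min (φ x) (φ y)} ∧
        (SOS.sosMeasure Λ β).real {φ | (n : ℤ) ≤ min (φ x) (φ y)} ≤
          C * Real.exp (-6 * β * n)) ∧
      (∀ x y z : Λ, x ≠ z → SOS.Adj x y → SOS.Adj y z →
        (1 / 8) * Real.exp (-8 * β * n) ≤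
          (SOS.sosMeasure Λ β).real {φ | (n : ℤ) ≤ min (φ x) (min (φ y) (φ z))} ∧
        (SOS.sosMeasure Λ β).real {φ | (n : ℤ) ≤ min (φ x) (min (φ y) (φ z))} ≤
          C * n * Real.exp (-8 * β * n) ∧
        ((x : ℤ × ℤ) + (z : ℤ × ℤ) = (y : ℤ × ℤ) + (y : ℤ × ℤ) →
          (SOS.sosMeasure Λ β).real {φ | (n : ℤ) ≤ min (φ x) (min (φ y) (φ z))} ≤
            C * Real.exp (-8 * β * n))) := by
  classical
  have hC : 0 ≤ SOS.upperConst β := (Real.exp_pos _).le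
  have hexp : ∀ t : ℝ, SOS.upperConst β * Real.exp t ≤ 2 * SOS.upperConst β * Real.exp t :=
    fun t => mul_le_mul_of_nonneg_right (by linarith) (Real.exp_pos t).le
  -- The factor 2 absorbs n + 1 ≤ 2n in the bound for three vertices.
  refine ⟨2 * SOS.upperConst β, fun n hn Λ => ⟨fun x => ⟨?_, ?_⟩, fun x y hxy => ⟨?_, ?_⟩,
    fun x y z hxz hxy hyz => ?_⟩⟩
  · have h := SOS.le_sosMeasure_real_forall hβ n {x} ∅ 4 (by simp) (by simp)
    simpa using h
  · have h := SOS.sosMeasure_real_le_one (Λ := Λ) hβ hsum n x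
    simp only [Finset.mem_singleton, forall_eq, SOS.extend_coe] at h
    exact h.trans (hexp _)
  · obtain ⟨e, he⟩ := SOS.exists_edge_of_adj hxy
    have hne : x ≠ y := fun h => hxy.ne (congrArg Subtype.val h)
    have h := SOS.le_sosMeasure_real_forall hβ n {x, y} {e} 6
      (by rw [Finset.card_pair hne, Finset.card_singleton]) (by
        intro e' he'
        rw [Finset.mem_singleton.1 he']
        rcases he with ⟨h1, h2⟩ | ⟨h1, h2⟩ <;> simp [h1, h2])
    rw [Finset.card_pair hne] at h
    simp only [Finset.mem_insert, Finset.mem_singleton, forall_eq_or_imp, forall_eq] at h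
    simp only [le_min_iff]
    norm_num at h ⊢
    exact h
  · have h := SOS.sosMeasure_real_le_two (Λ := Λ) hβ hsum n hxy
    simp only [Finset.mem_insert, Finset.mem_singleton, forall_eq_or_imp, forall_eq,
      SOS.extend_coe] at h
    simp only [le_min_iff]
    exact h.trans (hexp _)
  · have hne : x ≠ y := fun h => hxy.ne (congrArg Subtype.val h)
    have hne' : y ≠ z := fun h => hyz.ne (congrArg Subtype.val h)
    have hxz' : (x : ℤ × ℤ) ≠ z := fun h => hxz (Subtype.ext h)
    simp only [le_min_iff]
    refine ⟨?_, ?_, fun hal => ?_⟩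
    · obtain ⟨e, he⟩ := SOS.exists_edge_of_adj hxy
      obtain ⟨e', he'⟩ := SOS.exists_edge_of_adj hyz
      have hee : e ≠ e' := by
        rintro rfl
        rcases he with ⟨h1, h2⟩ | ⟨h1, h2⟩ <;> rcases he' with ⟨h3, h4⟩ | ⟨h3, h4⟩
        · exact hxy.ne (h1.symm.trans h3)
        · exact hxz' (h1.symm.trans h3)
        · exact hxz' (h2.symm.trans h4)
        · exact hyz.ne (h1.symm.trans h3)
      have hcard : ({x, y, z} : Finset Λ).card = 3 :=
        Finset.card_eq_three.2 ⟨x, y, z, hne, hxz, hne', rfl⟩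
      -- The perimeter is 4 · 3 - 2 · 2 = 8, whether or not the triple is aligned.
      have h := SOS.le_sosMeasure_real_forall hβ n {x, y, z} {e, e'} 8
        (by rw [hcard, Finset.card_pair hee]) (by
          intro e'' he''
          rcases Finset.mem_insert.1 he'' with rfl | he''
          · rcases he with ⟨h1, h2⟩ | ⟨h1, h2⟩ <;> simp [h1, h2]
          · rw [Finset.mem_singleton.1 he'']
            rcases he' with ⟨h1, h2⟩ | ⟨h1, h2⟩ <;> simp [h1, h2])
      rw [hcard] at h
      simp only [Finset.mem_insert, Finset.mem_singleton, forall_eq_or_imp, forall_eq] at h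
      norm_num at h ⊢
      exact h
    · have h := SOS.sosMeasure_real_le_three (Λ := Λ) hβ hsum n hxy hyz hxz'
      simp only [Finset.mem_insert, Finset.mem_singleton, forall_eq_or_imp, forall_eq,
        SOS.extend_coe] at h
      refine h.trans (mul_le_mul_of_nonneg_right ?_ (Real.exp_pos _).le)
      have : (1 : ℝ) ≤ n := by exact_mod_cast hn
      nlinarith
    · have h := SOS.sosMeasure_real_le_three_aligned (Λ := Λ) hβ hsum n hxy hyz hxz' hal
      simp only [Finset.mem_insert, Finset.mem_singleton, forall_eq_or_imp, forall_eq,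
        SOS.extend_coe] at h
      exact h.trans (hexp _)
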